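/- Let $p$ be a prime, let $\mathbf{R}$ be the ring of algebraic integers in $\mathbb{C}$, and let $M$ be a maximal ideal of $\mathbf{R}$ containing $p$. For a finite group $G$ let $\operatorname{Irr}(G)$ be the set of irreducible complex characters of $G$. For $\chi\in\operatorname{Irr}(G)$ and a conjugacy class $K$ of $G$ with $g\in K$, put $\omega_\chi(K^+)=|K|\chi(g)/\chi(1)\in\mathbf{R}$. A $p$-block $B$ of $G$ is given by its set $\operatorname{Irr}(B)\subseteq\operatorname{Irr}(G)$ of irreducible characters, which is an equivalence class of $\operatorname{Irr}(G)$ under the relation $\chi\sim\psi$ if and only if $\omega_\chi(K^+)\equiv\omega_\psi(K^+)\pmod{M}$ for all conjugacy classes $K$ of $G$. Let $\mathbb{Z}\operatorname{Irr}(B)$ be the group of integral linear combinations of $\operatorname{Irr}(B)$, endowed with the scalar product $[\chi,\psi]=\frac{1}{|G|}\sum_{g\in G}\chi(g)\psi(g^{-1})$. Let $B$ and $B'$ be $p$-blocks of finite groups $G$ and $H$. An isometry (that is, a group isomorphism preserving the scalar products) $I:\mathbb{Z}\operatorname{Irr}(B)\to\mathbb{Z}\operatorname{Irr}(B')$ is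 called perfect if the map $\mu_I:G\times H\to\mathbb{C}$, $\mu_I(g,h)=\sum_{\chi\in\operatorname{Irr}(B)}\chi(g)\,I(\chi)(h)$ satisfies the following conditions: (sep) if exactly one of $g$ and $h$ is $p$-regular (i.e. has order not divisible by $p$), then $\mu_I(g,h)=0$; (int) $\mu_I(g,h)/|\operatorname{C}_G(g)|_p$ and $\mu_I(g,h)/|\operatorname{C}_H(h)|_p$ are algebraic integers for all $g\in G$ and $h\in H$, where $n_p$ denotes the largest power of $p$ dividing $n$. Then the following hold. (1) If $I,J:\mathbb{Z}\operatorname{Irr}(B)\to\mathbb{Z}\operatorname{Irr}(B')$ are perfect isometries such that $I(\chi)=\pm J(\chi)$ for every $\chi\in\operatorname{Irr}(B)$ (where the sign may depend on $\chi$), then $I=J$ or $I=-J$. (2) The perfect isometries $\mathbb{Z}\operatorname{Irr}(B)\to\mathbb{Z}\operatorname{Irr}(B)$ form a group $\operatorname{PI}(B)$ under composition, $-\mathrm{id}$ belongs to $\operatorname{PI}(B)$, the subgroup $\langle-\mathrm{id}\rangle$ is normal in $\operatorname{PI}(B)$, and there is an injective group homomorphism $\operatorname{PI}(B)/\langle-\mathrm{id}\rangle\to\operatorname{Sym}(\operatorname{Irr}(B))$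 sending the class of $I$ to the permutation $\widehat{I}$ of $\operatorname{Irr}(B)$ that satisfies $I(\chi)=\pm\widehat{I}(\chi)$ for all $\chi\in\operatorname{Irr}(B)$. -/

import Mathlib

namespace PerfIso

/-- The set `Irr(G)` of irreducible complex characters of `G`, as functions `G → ℂ`. -/
def Irr (G : Type*) [Group G] : Set (G → ℂ) :=
  {χ | ∃ (n : ℕ) (ρ : Representation ℂ G (Fin n → ℂ)), ρ.IsIrreducible ∧ ρ.character = χ}

/-- The usual scalar product `[χ, ψ] = |G|⁻¹ ∑ χ(g) ψ(g⁻¹)`. -/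
noncomputable def scalarProd {G : Type*} [Group G] [Fintype G] (χ ψ : G → ℂ) : ℂ :=
  (Nat.card G : ℂ)⁻¹ * ∑ g : G, χ g * ψ g⁻¹

open scoped Classical in
theorem scalarProd_irr {G : Type*} [Group G] [Fintype G] {χ ψ : G → ℂ}
    (hχ : χ ∈ Irr G) (hψ : ψ ∈ Irr G) : scalarProd χ ψ = if χ = ψ then 1 else 0 := by
  obtain ⟨n, ρ, hρ, rfl⟩ := hχ
  obtain ⟨m, σ, hσ, rfl⟩ := hψ
  have : Invertible (Nat.card G : ℂ) :=
    invertibleOfNonzero (Nat.cast_ne_zero.mpr Nat.card_pos.ne')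
  have h := Representation.char_orthonormal ρ σ
  unfold scalarProd
  rw [h]
  by_cases he : Nonempty (σ.Equiv ρ)
  · rw [if_pos he, if_pos (Representation.char_iso he.some).symm]
  · rw [if_neg he, if_neg]
    intro hc
    have h2 := Representation.char_orthonormal ρ ρ
    rw [if_pos ⟨Representation.Equiv.refl ρ⟩] at h2
    rw [if_neg he, ← hc, h2] at h
    exact one_ne_zero h

theorem linearIndependent_irr (G : Type*) [Group G] [Fintype G] :
    LinearIndependent ℂ (fun χ : Irr G => (χ : G → ℂ)) := by
  classical
  rw [linearIndependent_iff']
  intro s c hc ψ hψ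
  have key : scalarProd (∑ χ ∈ s, c χ • (χ : G → ℂ)) ψ = c ψ := by
    have : scalarProd (∑ χ ∈ s, c χ • (χ : G → ℂ)) ψ
        = ∑ χ ∈ s, c χ * scalarProd (χ : G → ℂ) ψ := by
      simp only [scalarProd, Finset.sum_apply, Pi.smul_apply, smul_eq_mul, Finset.sum_mul,
        Finset.mul_sum]
      rw [Finset.sum_comm]
      refine Finset.sum_congr rfl fun χ _ => Finset.sum_congr rfl fun g _ => by ring
    rw [this, Finset.sum_eq_single ψ]
    · simp [scalarProd_irr ψ.2 ψ.2]
    · intro χ _ hne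
      rw [scalarProd_irr χ.2 ψ.2, if_neg (fun h => hne (Subtype.ext h)), mul_zero]
    · exact fun h => absurd hψ h
  rw [← key, hc]
  simp [scalarProd]

theorem finite_irr (G : Type*) [Group G] [Fintype G] : (Irr G).Finite :=
  (linearIndependent_irr G).setFinite

/-- The value `ω_χ(K⁺) = |K| χ(g) / χ(1)` of the central character of `χ` at the sum of the
conjugacy class `K` of `g`. -/
noncomputable def centralChar {G : Type*} [Group G] (χ : G → ℂ) (g : G) : ℂ :=
  (Nat.card (conjugatesOf g) : ℂ) * χ g / χ 1

/-- `χ` and `ψ` have the same central character modulo `M`, where `M` is an ideal of the ring of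
all algebraic integers: `ω_χ(K⁺) - ω_ψ(K⁺)` lies in `M` for every conjugacy class `K`
(for irreducible characters both numbers are algebraic integers). -/
def SameBlock (M : Ideal (integralClosure ℤ ℂ)) {G : Type*} [Group G] (χ ψ : G → ℂ) : Prop :=
  ∀ g : G, ∃ m ∈ M, (m : ℂ) = centralChar χ g - centralChar ψ g

/-- A block of `G`, as a set of irreducible characters: a class of `Irr(G)` under equality of
central characters modulo `M`. If `M` is a maximal ideal containing the prime `p`, these are the
`p`-blocks of `G`. -/
structure Block (M : Ideal (integralClosure ℤ ℂ)) (G : Type*) [Group G] where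
  /-- The set `Irr(B)`. -/
  irr : Set (G → ℂ)
  exists_eq : ∃ χ ∈ Irr G, irr = {ψ | ψ ∈ Irr G ∧ SameBlock M χ ψ}

namespace Block

variable {M : Ideal (integralClosure ℤ ℂ)} {G : Type*} [Group G]

theorem irr_subset (B : Block M G) : B.irr ⊆ Irr G := by
  obtain ⟨χ, -, h⟩ := B.exists_eq
  rw [h]
  exact fun ψ hψ => hψ.1

noncomputable instance [Fintype G] (B : Block M G) : Fintype B.irr :=
  ((finite_irr G).subset B.irr_subset).fintype

/-- The group `ℤIrr(B)` of generalized characters of `B`. -/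
def ZIrr (B : Block M G) : Submodule ℤ (G → ℂ) := Submodule.span ℤ B.irr

/-- An irreducible character of `B` as an element of `ℤIrr(B)`. -/
def toZIrr (B : Block M G) (χ : B.irr) : B.ZIrr := ⟨χ, Submodule.subset_span χ.2⟩

end Block

/-- `g` is `p`-regular: `p` does not divide the order of `g`. -/
def IsPRegular (p : ℕ) {G : Type*} [Group G] (g : G) : Prop := ¬ p ∣ orderOf g

/-- The `p`-part `|C_G(g)|_p` of the order of the centralizer of `g`. -/
noncomputable def centralizerPPart (p : ℕ) {G : Type*} [Group G] (g : G) : ℕ :=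
  p ^ (Nat.card (Subgroup.centralizer {g})).factorization p

section

variable {M : Ideal (integralClosure ℤ ℂ)} {G H : Type*} [Group G] [Fintype G] [Group H]
  [Fintype H] {B : Block M G} {B' : Block M H}

/-- `μ_I(g, h) = ∑_{χ ∈ Irr(B)} χ(g) I(χ)(h)`. -/
noncomputable def mu (I : B.ZIrr ≃ₗ[ℤ] B'.ZIrr) (g : G) (h : H) : ℂ :=
  ∑ χ : B.irr, (χ : G → ℂ) g * (I (B.toZIrr χ) : H → ℂ) h

/-- `I : ℤIrr(B) → ℤIrr(B')` is a perfect isometry (with respect to the prime `p`). -/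
structure IsPerfectIsometry (p : ℕ) (I : B.ZIrr ≃ₗ[ℤ] B'.ZIrr) : Prop where
  isometry : ∀ x y : B.ZIrr,
    scalarProd (I x : H → ℂ) (I y : H → ℂ) = scalarProd (x : G → ℂ) (y : G → ℂ)
  sep : ∀ (g : G) (h : H), Xor (IsPRegular p g) (IsPRegular p h) → mu I g h = 0
  int_left : ∀ (g : G) (h : H), IsIntegral ℤ (mu I g h / (centralizerPPart p g : ℂ))
  int_right : ∀ (g : G) (h : H), IsIntegral ℤ (mu I g h / (centralizerPPart p h : ℂ))

end

end PerfIso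

/-! Composing with `J.symm` reduces (1) to a perfect isometry `I` of one block `B` that fixes every
irreducible character up to sign. Let `S` be the set of characters fixed with sign `+`. On pairs
(p-regular, p-singular) both `mu I` and `mu` of the identity vanish, hence so does half their sum,
which is `∑ χ ∈ S, χ g * χ u`. A set with this property (`IsSeparating`) is a union of blocks, by
`IsSeparating.mem_of_sameBlock`: up to a factor prime to `p`, the central idempotent of `S` has
algebraic integer coefficients, so central characters mod `M` distinguish `S` from its complement.
Thus `S` is empty or all of `Irr(B)`, and `I` is `-1` or `1`.

The vanishing for the identity is `block_orthogonality`. It comes from high p-power powers of an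
element of the integral group ring, whose coefficient sums over p-singular classes are highly
divisible by `p` (`pow_dvd_sum_coeff_pow`). With the integrality lemma
`IsSeparating.isIntegral_div_centralizer` it makes the identity perfect. Composites are handled by
convolution (`mu_trans`) and inverses by transposition (`mu_symm`).

An isometry sends an irreducible character, a vector of norm 1, to a signed irreducible character.
This defines `I ↦ Î`, and (1) identifies the kernel as `⟨-1⟩`. -/

namespace PerfIso

open Module Finset

/-! ### Character theory: Schur's lemma, integrality, column orthogonality -/

section Characters

variable {G : Type*} [Group G]

section Irreducible

variable {V : Type*} [AddCommGroup V] [Module ℂ V] [FiniteDimensional ℂ V]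

omit [FiniteDimensional ℂ V] in
theorem isIrreducible_of_equiv {W : Type*} [AddCommGroup W] [Module ℂ W]
    {ρ : Representation ℂ G V} {σ : Representation ℂ G W} (e : ρ.Equiv σ)
    (h : ρ.IsIrreducible) : σ.IsIrreducible := by
  rw [Representation.irreducible_iff_isSimpleModule_asModule] at h ⊢
  let f : σ.asModule →ₗ[MonoidAlgebra ℂ G] ρ.asModule :=
    Representation.IntertwiningMap.equivLinearMapAsModule σ ρ e.symm.toIntertwiningMap
  exact IsSimpleModule.congr (LinearEquiv.ofBijective f e.symm.toLinearEquiv.bijective)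

theorem character_mem_irr (ρ : Representation ℂ G V) (h : ρ.IsIrreducible) :
    ρ.character ∈ Irr G := by
  let e : V ≃ₗ[ℂ] (Fin (finrank ℂ V) → ℂ) := (finBasis ℂ V).equivFun
  let σ : Representation ℂ G (Fin (finrank ℂ V) → ℂ) := e.conjRingEquiv.toMonoidHom.comp ρ
  let E : ρ.Equiv σ := Representation.Equiv.mk e (by
    intro g; ext v; simp [σ])
  exact ⟨_, σ, isIrreducible_of_equiv E h, (Representation.char_iso E).symm⟩

theorem exists_eq_smul_one_of_commute (ρ : Representation ℂ G V) [ρ.IsIrreducible]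
    (T : End ℂ V) (hT : ∀ g, ρ g * T = T * ρ g) : ∃ c : ℂ, T = c • 1 := by
  let f : Representation.IntertwiningMap ρ ρ := ⟨T, fun g => (hT g).symm⟩
  obtain ⟨c, hc⟩ :=
    (Representation.IsIrreducible.algebraMap_intertwiningMap_bijective_of_isAlgClosed
      (ρ := ρ)).2 f
  refine ⟨c, ?_⟩
  have := congrArg Representation.IntertwiningMap.toLinearMap hc
  rw [show T = f.toLinearMap from rfl, ← this]
  rfl

theorem finrank_ne_zero_of_isIrreducible (ρ : Representation ℂ G V) [h : ρ.IsIrreducible] :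
    (finrank ℂ V : ℂ) ≠ 0 := by
  rw [Representation.irreducible_iff_isSimpleModule_asModule] at h
  have : Nontrivial ρ.asModule := IsSimpleModule.nontrivial (MonoidAlgebra ℂ G) _
  have : Nontrivial V := ρ.asModuleEquiv.symm.toEquiv.nontrivial
  exact_mod_cast (finrank_pos (R := ℂ) (M := V)).ne'

theorem isIntegral_trace_of_pow_eq_one (T : End ℂ V) {n : ℕ} (hn : 0 < n) (hT : T ^ n = 1) :
    IsIntegral ℤ (LinearMap.trace ℂ V T) := by
  rw [Module.End.trace_eq_sum_roots_charpoly_of_splits (IsAlgClosed.splits _)]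
  refine Multiset.sum_induction _ _ (fun _ _ => IsIntegral.add) isIntegral_zero ?_
  intro μ hμ
  have hev : T.HasEigenvalue μ :=
    (Module.End.hasEigenvalue_iff_isRoot_charpoly T μ).2 (Polynomial.isRoot_of_mem_roots hμ)
  obtain ⟨v, hv⟩ := hev.exists_hasEigenvector
  have h1 := hv.pow_apply n
  rw [hT, Module.End.one_apply] at h1
  have h2 : μ ^ n = 1 := by
    have : (μ ^ n - 1) • v = 0 := by rw [sub_smul, ← h1, one_smul, sub_self]
    exact sub_eq_zero.1 ((smul_eq_zero.1 this).resolve_right hv.2)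
  exact IsIntegral.of_pow hn (h2 ▸ isIntegral_one)

end Irreducible

theorem irr_one_ne_zero {χ : G → ℂ} (hχ : χ ∈ Irr G) : χ 1 ≠ 0 := by
  obtain ⟨n, ρ, hρ, rfl⟩ := hχ
  rw [Representation.char_one]
  exact finrank_ne_zero_of_isIrreducible ρ

theorem irr_conj {χ : G → ℂ} (hχ : χ ∈ Irr G) {g h : G} (hgh : IsConj g h) : χ g = χ h := by
  obtain ⟨n, ρ, hρ, rfl⟩ := hχ
  obtain ⟨c, rfl⟩ := isConj_iff.1 hgh
  rw [Representation.char_conj]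

variable [Fintype G]

theorem isIntegral_irr {χ : G → ℂ} (hχ : χ ∈ Irr G) (g : G) : IsIntegral ℤ (χ g) := by
  obtain ⟨n, ρ, hρ, rfl⟩ := hχ
  refine isIntegral_trace_of_pow_eq_one _ (orderOf_pos g) ?_
  rw [← map_pow, pow_orderOf_eq_one, map_one]

-- Conjugation by `g` permutes the class; with `F` a representation this says that class sums are
-- central.
open scoped Classical in
theorem sum_filter_isConj_mul {A : Type*} [AddCommMonoid A] (F : G → A) (h g : G) :
    ∑ k with IsConj h k, F (g * k) = ∑ k with IsConj h k, F (k * g) := by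
  refine sum_bij' (fun k _ => g * k * g⁻¹) (fun k _ => g⁻¹ * k * g) ?_ ?_ ?_ ?_ ?_
  · intro k hk
    simp only [mem_filter, mem_univ, true_and] at hk ⊢
    exact hk.trans (isConj_iff.2 ⟨g, rfl⟩)
  · intro k hk
    simp only [mem_filter, mem_univ, true_and] at hk ⊢
    exact hk.trans (isConj_iff.2 ⟨g⁻¹, by simp⟩)
  all_goals intros; simp [mul_assoc]

open scoped Classical in
theorem card_conjugatesOf (h : G) :
    Nat.card (conjugatesOf h) = #{k | IsConj h k} := by
  rw [Nat.card_eq_fintype_card, Fintype.card_subtype]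
  congr 1
  ext k
  simp [conjugatesOf]

open scoped Classical in
theorem sum_class_eq_centralChar {n : ℕ} (ρ : Representation ℂ G (Fin n → ℂ))
    [ρ.IsIrreducible] (h : G) :
    ∑ k with IsConj h k, ρ k = centralChar ρ.character h • (1 : End ℂ (Fin n → ℂ)) := by
  obtain ⟨c, hc⟩ := exists_eq_smul_one_of_commute ρ (∑ k with IsConj h k, ρ k) (by
    intro g
    rw [mul_sum, sum_mul]
    simp_rw [← map_mul]
    exact sum_filter_isConj_mul (fun k => ρ k) h g)
  have htr := congrArg (LinearMap.trace ℂ _) hc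
  rw [map_sum, map_smul, LinearMap.trace_one] at htr
  have h2 : ∑ k with IsConj h k, LinearMap.trace ℂ (Fin n → ℂ) (ρ k)
      = Nat.card (conjugatesOf h) * ρ.character h := by
    rw [card_conjugatesOf, ← nsmul_eq_mul, ← sum_const]
    refine sum_congr rfl fun k hk => ?_
    exact (irr_conj ⟨n, ρ, ‹_›, rfl⟩ (mem_filter.1 hk).2).symm
  rw [h2] at htr
  have h0 := finrank_ne_zero_of_isIrreducible ρ
  rw [hc, centralChar, Representation.char_one, htr, smul_eq_mul, mul_div_cancel_right₀ _ h0]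

-- The class sum is integral because `ℤG` is a finite `ℤ`-module, and it acts on the representation
-- as the scalar `centralChar`.
open scoped Classical in
theorem isIntegral_centralChar {χ : G → ℂ} (hχ : χ ∈ Irr G) (h : G) :
    IsIntegral ℤ (centralChar χ h) := by
  obtain ⟨n, ρ, hρ, rfl⟩ := hχ
  have h1 : IsIntegral ℤ (∑ k with IsConj h k, MonoidAlgebra.of ℤ G k) := IsIntegral.of_finite ℤ _
  have h2 := h1.map (MonoidAlgebra.lift ℤ (End ℂ (Fin n → ℂ)) G ρ)
  simp only [map_sum, MonoidAlgebra.lift_of] at h2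
  rw [sum_class_eq_centralChar ρ h, ← Algebra.algebraMap_eq_smul_one] at h2
  have : Nontrivial (Fin n → ℂ) := by
    by_contra hc
    rw [not_nontrivial_iff_subsingleton] at hc
    exact finrank_ne_zero_of_isIrreducible ρ (by rw [finrank_zero_of_subsingleton]; simp)
  exact (isIntegral_algebraMap_iff (FaithfulSMul.algebraMap_injective ℂ _)).1 h2

open scoped Classical in
/-- `χ(g) ω_χ(K⁺) = ∑_{k ∈ K} χ(k g)`. -/
theorem sum_class_irr_mul {χ : G → ℂ} (hχ : χ ∈ Irr G) (h g : G) :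
    ∑ k with IsConj h k, χ (k * g) = centralChar χ h * χ g := by
  obtain ⟨n, ρ, hρ, rfl⟩ := hχ
  have := congrArg (fun T => LinearMap.trace ℂ _ (T * ρ g)) (sum_class_eq_centralChar ρ h)
  simpa [sum_mul, ← map_mul, Representation.character] using this

/-- A class function orthogonal to all irreducible characters vanishes. -/
theorem eq_zero_of_scalarProd_irr_eq_zero (f : G → ℂ) (hf : ∀ g h, IsConj g h → f g = f h)
    (h0 : ∀ χ ∈ Irr G, scalarProd χ f = 0) : f = 0 := by
  classical
  -- `F` is central, so it acts on a simple left ideal with character `χ` as a scalar, and the trace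
  -- of this action is `|G| [χ, f] = 0`. By semisimplicity `F` then kills the whole group algebra,
  -- in particular `1`.
  let F : MonoidAlgebra ℂ G := ∑ g, MonoidAlgebra.single g (f g⁻¹)
  have hzero : ∀ S : Submodule (MonoidAlgebra ℂ G) (MonoidAlgebra ℂ G),
      IsSimpleModule (MonoidAlgebra ℂ G) S → ∀ x ∈ S, F * x = 0 := by
    intro S hS x hx
    let ρ : Representation ℂ G S := Representation.ofModule' S
    have hact : ∀ (r : MonoidAlgebra ℂ G) (m : S), ρ.asAlgebraHom r m = r • m := fun r m => by
      have : ρ.asAlgebraHom = Algebra.lsmul ℂ ℂ S :=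
        (MonoidAlgebra.lift ℂ (End ℂ S) G).apply_symm_apply _
      rw [this]; rfl
    have hρ : ρ.IsIrreducible := by
      rw [Representation.irreducible_iff_isSimpleModule_asModule]
      let e : ρ.asModule ≃ₗ[MonoidAlgebra ℂ G] S :=
        { ρ.asModuleEquiv.toAddEquiv with
          map_smul' := fun r m => (ρ.asModuleEquiv_map_smul r m).trans (hact r _) }
      exact IsSimpleModule.congr e
    have : FiniteDimensional ℂ S := Module.Finite.trans (MonoidAlgebra ℂ G) _
    have hFρ : ρ.asAlgebraHom F = ∑ g, f g⁻¹ • ρ g := by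
      simp only [F, map_sum, Representation.asAlgebraHom_single]
    obtain ⟨c, hc⟩ := exists_eq_smul_one_of_commute ρ (ρ.asAlgebraHom F) (by
      intro g
      rw [hFρ, mul_sum, sum_mul]
      refine sum_bij' (fun k _ => g * k * g⁻¹) (fun k _ => g⁻¹ * k * g) ?_ ?_ ?_ ?_ ?_
      · simp
      · simp
      · intros; simp [mul_assoc]
      · intros; simp [mul_assoc]
      · intro k _
        rw [mul_smul_comm, smul_mul_assoc, ← map_mul, ← map_mul]
        congr 1
        · exact hf _ _ (isConj_iff.2 ⟨g, by simp [mul_assoc]⟩)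
        · congr 1; group)
    have htr : LinearMap.trace ℂ _ (ρ.asAlgebraHom F) = 0 := by
      have h1 := h0 _ (character_mem_irr ρ hρ)
      rw [scalarProd, mul_eq_zero] at h1
      have h2 := h1.resolve_left
        (inv_ne_zero (Nat.cast_ne_zero.2 (Nat.card_pos (α := G)).ne'))
      rw [hFρ, map_sum, ← h2]
      refine sum_congr rfl fun g _ => ?_
      rw [map_smul, smul_eq_mul, mul_comm]; rfl
    rw [hc, map_smul, LinearMap.trace_one, smul_eq_mul] at htr
    have hc0 : c = 0 := (mul_eq_zero.1 htr).resolve_right (finrank_ne_zero_of_isIrreducible ρ)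
    rw [hc0, zero_smul] at hc
    have h3 := hact F ⟨x, hx⟩
    rw [hc, LinearMap.zero_apply] at h3
    exact (congrArg Subtype.val h3).symm
  have hall : ∀ x : MonoidAlgebra ℂ G, F * x = 0 := by
    let K : AddSubgroup (MonoidAlgebra ℂ G) := (AddMonoidHom.mulLeft F).ker
    intro x
    have hx : x ∈ sSup {m : Submodule (MonoidAlgebra ℂ G) (MonoidAlgebra ℂ G) |
        IsSimpleModule (MonoidAlgebra ℂ G) m} := by
      have : NeZero (Nat.card G : ℂ) := ⟨Nat.cast_ne_zero.2 (Nat.card_pos (α := G)).ne'⟩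
      rw [IsSemisimpleModule.sSup_simples_eq_top]; trivial
    rw [sSup_eq_iSup'] at hx
    refine Submodule.iSup_induction _ (motive := fun y => F * y = 0) hx ?_ (mul_zero _) ?_
    · intro S y hy; exact hzero S.1 S.2 y hy
    · intro y z hy hz; rw [mul_add, hy, hz, add_zero]
  have hF : F = 0 := by simpa using hall 1
  funext g
  have : F.coeff g⁻¹ = f g := by
    simp [F, MonoidAlgebra.coeff_sum, Finsupp.single_apply]
  rw [← this, hF]; rfl

theorem scalarProd_comm (f g : G → ℂ) : scalarProd f g = scalarProd g f := by
  unfold scalarProd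
  congr 1
  rw [← Equiv.sum_comp (Equiv.inv G)]
  exact sum_congr rfl fun x _ => by simp [mul_comm]

theorem scalarProd_sum_left {ι : Type*} (s : Finset ι) (c : ι → ℂ) (f : ι → G → ℂ) (ψ : G → ℂ) :
    scalarProd (∑ i ∈ s, c i • f i) ψ = ∑ i ∈ s, c i * scalarProd (f i) ψ := by
  simp only [scalarProd, Finset.sum_apply, Pi.smul_apply, smul_eq_mul, Finset.sum_mul,
    Finset.mul_sum]
  rw [Finset.sum_comm]
  exact Finset.sum_congr rfl fun χ _ => Finset.sum_congr rfl fun g _ => by ring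

variable (G) in
/-- The set `Irr(G)` as a finset. -/
noncomputable def irrFinset : Finset (G → ℂ) := (finite_irr G).toFinset

@[simp]
theorem mem_irrFinset {χ : G → ℂ} : χ ∈ irrFinset G ↔ χ ∈ Irr G := by simp [irrFinset]

theorem eq_sum_scalarProd_smul_irr (f : G → ℂ) (hf : ∀ g h, IsConj g h → f g = f h) :
    f = ∑ χ ∈ irrFinset G, scalarProd f χ • χ := by
  classical
  rw [← sub_eq_zero]
  refine eq_zero_of_scalarProd_irr_eq_zero _ ?_ ?_
  · intro g h hgh
    simp only [Pi.sub_apply, Finset.sum_apply, Pi.smul_apply, smul_eq_mul]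
    rw [hf g h hgh]
    congr 1
    exact sum_congr rfl fun χ hχ => by rw [irr_conj (mem_irrFinset.1 hχ) hgh]
  · intro χ hχ
    have h1 : scalarProd χ (f - ∑ ψ ∈ irrFinset G, scalarProd f ψ • ψ)
        = scalarProd χ f - scalarProd χ (∑ ψ ∈ irrFinset G, scalarProd f ψ • ψ) := by
      simp [scalarProd, mul_sub]
    rw [h1, scalarProd_comm χ (∑ _ ∈ _, _), scalarProd_sum_left,
      sum_eq_single χ, scalarProd_irr hχ hχ, if_pos rfl, scalarProd_comm, mul_one, sub_self]
    · intro ψ hψ hne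
      rw [scalarProd_irr (mem_irrFinset.1 hψ) hχ, if_neg hne, mul_zero]
    · intro h; exact absurd (mem_irrFinset.2 hχ) h

omit [Fintype G] in
theorem isConj_inv_inv {g h : G} (hc : IsConj g h) : IsConj g⁻¹ h⁻¹ := by
  obtain ⟨c, rfl⟩ := isConj_iff.1 hc
  exact isConj_iff.2 ⟨c, by group⟩

open scoped Classical in
/-- Column orthogonality, in the form of an expansion of the indicator of a class. -/
theorem card_mul_indicator_eq_sum (y g : G) :
    (if IsConj y g then (Nat.card G : ℂ) else 0)
      = Nat.card (conjugatesOf y) * ∑ χ ∈ irrFinset G, χ y⁻¹ * χ g := by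
  have hN : (Nat.card G : ℂ) ≠ 0 := Nat.cast_ne_zero.2 (Nat.card_pos (α := G)).ne'
  have h := congrFun (eq_sum_scalarProd_smul_irr
    (fun g => if IsConj y g then (Nat.card G : ℂ) else 0) (by
      intro a b hab
      have : IsConj y a ↔ IsConj y b := ⟨fun h => h.trans hab, fun h => h.trans hab.symm⟩
      simp only [this])) g
  rw [h, Finset.sum_apply, mul_sum]
  refine sum_congr rfl fun χ hχ => ?_
  rw [Pi.smul_apply, smul_eq_mul, ← mul_assoc]
  congr 1
  simp only [scalarProd, ite_mul, zero_mul]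
  rw [← sum_filter, sum_congr rfl (g := fun _ => (Nat.card G : ℂ) * χ y⁻¹), sum_const,
    card_conjugatesOf, nsmul_eq_mul]
  · field_simp
  · intro k hk
    rw [irr_conj (mem_irrFinset.1 hχ) (isConj_inv_inv (mem_filter.1 hk).2)]

end Characters

/-! ### Coefficients of p-power powers in a group ring -/

section CyclicSums

/-- Orbits of `σ` have p-power length, and an orbit on which `f` is nonzero is not fixed by `σ ^ p ^
m`, so its length is divisible by `p ^ (m + 1)`. -/
theorem pow_dvd_sum_of_perm {X A : Type*} [Fintype X] [CommRing A] {p : ℕ} [Fact p.Prime]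
    {k m : ℕ} (σ : Equiv.Perm X) (hσ : σ ^ p ^ k = 1) (f : X → A) (hf : ∀ x, f (σ x) = f x)
    (hm : ∀ x, f x ≠ 0 → (σ ^ p ^ m) x ≠ x) : (p : A) ^ (m + 1) ∣ ∑ x, f x := by
  classical
  let S := MulAction.orbitRel (Subgroup.zpowers σ) X
  have hinv : ∀ (τ : Subgroup.zpowers σ) x, f (τ • x) = f x := by
    rintro ⟨τ, hτ⟩ x
    have hstep : ∀ n : ℕ, ∀ y, f ((σ ^ n) y) = f y := by
      intro n
      induction n with
      | zero => simp
      | succ n ih => intro y; rw [pow_succ', Equiv.Perm.mul_apply, hf, ih]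
    obtain ⟨n, -, rfl⟩ := Finset.mem_image.1 (mem_zpowers_iff_mem_range_orderOf.1 hτ)
    exact hstep n x
  rw [← sum_fiberwise univ (fun x => (Quotient.mk S x)) f]
  refine dvd_sum fun q _ => ?_
  induction q using Quotient.inductionOn with
  | h x =>
  have hconst : ∀ y ∈ univ.filter (fun y => Quotient.mk S y = Quotient.mk S x), f y = f x := by
    intro y hy
    obtain ⟨τ, rfl⟩ := Quotient.exact (mem_filter.1 hy).2
    exact hinv τ x
  rw [sum_congr rfl hconst, sum_const]
  by_cases h0 : f x = 0
  · simp [h0]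
  have hcard : #(univ.filter (fun y => Quotient.mk S y = Quotient.mk S x))
      = Function.minimalPeriod (σ • ·) x := by
    rw [MulAction.minimalPeriod_eq_card, ← Set.toFinset_card]
    congr 1
    ext y
    simp only [mem_filter, mem_univ, true_and, Set.mem_toFinset]
    exact Quotient.eq
  have hper : Function.minimalPeriod (σ • ·) x ∣ p ^ k := by
    rw [← Function.isPeriodicPt_iff_minimalPeriod_dvd, Function.IsPeriodicPt, smul_iterate,
      hσ]
    exact one_smul _ x
  obtain ⟨j, -, hj⟩ := (Nat.dvd_prime_pow (Fact.out : p.Prime)).1 hper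
  have hmj : m + 1 ≤ j := by
    by_contra hlt
    refine hm x h0 ?_
    have h1 : Function.minimalPeriod (σ • ·) x ∣ p ^ m := hj ▸ pow_dvd_pow p (by omega)
    rw [← Function.isPeriodicPt_iff_minimalPeriod_dvd, Function.IsPeriodicPt, smul_iterate] at h1
    exact h1
  rw [hcard, hj, nsmul_eq_mul, Nat.cast_pow]
  exact Dvd.dvd.mul_right (pow_dvd_pow _ hmj) _

variable {G A : Type*} [Group G] [Fintype G] [CommRing A]

theorem monoidAlgebra_pow_eq_sum (w : MonoidAlgebra A G) (n : ℕ) :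
    w ^ n = ∑ t : Fin n → G,
      MonoidAlgebra.single (List.ofFn t).prod (∏ i, w.coeff (t i)) := by
  classical
  induction n with
  | zero => simp [MonoidAlgebra.one_def]
  | succ n ih =>
    have hw : w = ∑ g, MonoidAlgebra.single g (w.coeff g) := by
      apply MonoidAlgebra.coeff_injective
      ext g
      simp [MonoidAlgebra.coeff_sum]
    rw [pow_succ', ih, ← (Fin.consEquiv (fun _ => G)).sum_comp, Fintype.sum_prod_type]
    conv_lhs => rw [hw, sum_mul]
    refine sum_congr rfl fun g _ => ?_
    rw [mul_sum]
    refine sum_congr rfl fun t _ => ?_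
    rw [MonoidAlgebra.single_mul_single]
    simp [Fin.consEquiv, List.ofFn_succ, Fin.prod_univ_succ]

/-- The product `t₀ t₁ ⋯ tₙ₋₁`. -/
def seqProd (t : ℕ → G) : ℕ → G
  | 0 => 1
  | n + 1 => seqProd t n * t n

omit [Fintype G] in
theorem seqProd_add (t : ℕ → G) (m n : ℕ) :
    seqProd t (m + n) = seqProd t m * seqProd (fun i => t (i + m)) n := by
  induction n with
  | zero => simp [seqProd]
  | succ n ih => rw [← add_assoc, seqProd, ih, seqProd, mul_assoc, add_comm m n]

omit [Fintype G] in
theorem seqProd_mul_of_periodic (t : ℕ → G) (m n : ℕ) (h : ∀ i, t (i + m) = t i) :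
    seqProd t (m * n) = seqProd t m ^ n := by
  induction n with
  | zero => simp [seqProd]
  | succ n ih =>
    rw [mul_add, mul_one, add_comm, seqProd_add, pow_succ', ← ih]
    simp only [h]

omit [Fintype G] in
theorem ofFn_prod_eq_seqProd (t : ℕ → G) (n : ℕ) :
    (List.ofFn (fun i : Fin n => t i)).prod = seqProd t n := by
  induction n with
  | zero => simp [seqProd]
  | succ n ih => rw [List.ofFn_succ', List.concat_eq_append, List.prod_append, seqProd, ← ih]; simp

omit [Fintype G] in
theorem seqProd_shift (t : ℕ → G) (n : ℕ) (h : t n = t 0) :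
    seqProd (fun i => t (i + 1)) n = (t 0)⁻¹ * seqProd t n * t 0 := by
  have h1 := seqProd_add t 1 n
  have h2 : seqProd t (1 + n) = seqProd t n * t n := by rw [add_comm, seqProd]
  rw [h2, h] at h1
  simp only [seqProd, one_mul] at h1
  rw [mul_assoc, h1, inv_mul_cancel_left]

/-- The p-part of the order of `g` divides `p ^ c`, so the `n`-th power removes it. -/
theorem isPRegular_pow (p : ℕ) [Fact p.Prime] (g : G) {n c : ℕ}
    (hc : (Nat.card G).factorization p ≤ c) (hn : p ^ c ∣ n) : IsPRegular p (g ^ n) := by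
  intro hdvd
  have hp : p.Prime := Fact.out
  have h0 : orderOf g ≠ 0 := (orderOf_pos g).ne'
  have hg : (orderOf g).factorization p ≤ c :=
    le_trans ((Nat.factorization_le_iff_dvd h0 (Nat.card_pos (α := G)).ne').2
      (orderOf_dvd_natCard g) p) hc
  obtain ⟨r, hr⟩ : p ^ (orderOf g).factorization p ∣ n := (pow_dvd_pow p hg).trans hn
  have h1 : orderOf (g ^ n) ∣ orderOf g / p ^ (orderOf g).factorization p := by
    rw [orderOf_dvd_iff_pow_eq_one, ← pow_mul, hr, mul_right_comm, Nat.mul_div_cancel'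
      (Nat.ordProj_dvd _ _), pow_mul, pow_orderOf_eq_one, one_pow]
  exact Nat.not_dvd_ordCompl hp h0 (hdvd.trans h1)

omit [Fintype G] in
theorem isPRegular_conj (p : ℕ) {g h : G} (hc : IsConj g h) :
    IsPRegular p g ↔ IsPRegular p h := by
  obtain ⟨c, rfl⟩ := isConj_iff.1 hc
  unfold IsPRegular
  rw [show orderOf (c * g * c⁻¹) = orderOf g from
    orderOf_injective (MulAut.conj c).toMonoidHom (MulAut.conj c).injective g]

omit [Fintype G] in
theorem isPRegular_inv (p : ℕ) (g : G) : IsPRegular p g⁻¹ ↔ IsPRegular p g := by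
  unfold IsPRegular; rw [orderOf_inv]

theorem natCast_eq_finEquiv (q : ℕ) [NeZero q] (i : Fin q) :
    ((i : ℕ) : ZMod q) = ZMod.finEquiv q i := by
  cases q with
  | zero => exact i.elim0
  | succ n => exact Fin.cast_val_eq_self i

-- The coefficient sum runs over tuples whose product lies in the class of `y`. Rotating a tuple
-- conjugates its product, so the rotations act on these tuples; a tuple with period `p ^ m` would
-- make its product a `p ^ c`-th power, hence p-regular.
open scoped Classical in
theorem pow_dvd_sum_coeff_pow (p : ℕ) [Fact p.Prime] (w : MonoidAlgebra A G) (y : G)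
    (hy : ¬ IsPRegular p y) (m : ℕ) :
    (p : A) ^ (m + 1) ∣ ∑ g with IsConj y g,
      (w ^ p ^ (m + (Nat.card G).factorization p)).coeff g := by
  set c := (Nat.card G).factorization p
  have hp : p.Prime := Fact.out
  set q := p ^ (m + c) with hq
  have hq0 : q ≠ 0 := (pow_pos hp.pos _).ne'
  have : NeZero q := ⟨hq0⟩
  -- Indexing by `ZMod q` turns rotation into translation by 1, and the cast from `ℕ` turns a tuple
  -- into a `q`-periodic sequence.
  let f : (ZMod q → G) → A := fun t =>
    if IsConj y (seqProd (fun i => t i) q) then ∏ i, w.coeff (t i) else 0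
  have hsum : ∑ g with IsConj y g, (w ^ q).coeff g = ∑ t, f t := by
    let e : (Fin q → G) ≃ (ZMod q → G) :=
      Equiv.arrowCongr (ZMod.finEquiv q).toEquiv (Equiv.refl G)
    rw [monoidAlgebra_pow_eq_sum, MonoidAlgebra.coeff_sum, ← e.sum_comp]
    simp only [Finsupp.finsetSum_apply, MonoidAlgebra.coeff_single, Finsupp.single_apply]
    rw [sum_comm]
    refine sum_congr rfl fun t _ => ?_
    have h1 : seqProd (fun i => e t i) q = (List.ofFn t).prod := by
      rw [← ofFn_prod_eq_seqProd]
      congr 2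
      funext i
      have : (ZMod.finEquiv q).symm ((i : ℕ) : ZMod q) = i := by
        rw [natCast_eq_finEquiv, RingEquiv.symm_apply_apply]
      simp only [e, Equiv.arrowCongr_apply, Function.comp, Equiv.refl_apply]
      exact congrArg t this
    have h2 : ∏ i, w.coeff (e t i) = ∏ i, w.coeff (t i) := by
      rw [← (ZMod.finEquiv q).toEquiv.prod_comp]
      simp [e, Equiv.arrowCongr_apply]
    simp only [f, h1, h2, sum_ite_eq, mem_filter, mem_univ, true_and]
  rw [hsum]
  let σ : Equiv.Perm (ZMod q → G) := Equiv.arrowCongr (Equiv.subRight (1 : ZMod q)) (Equiv.refl G)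
  have hσ : ∀ (n : ℕ) (t : ZMod q → G) (i : ZMod q), (σ ^ n) t i = t (i + n) := by
    intro n
    induction n with
    | zero => simp
    | succ n ih =>
      intro t i
      rw [pow_succ, Equiv.Perm.mul_apply, ih]
      simp [σ, Equiv.arrowCongr_apply, add_assoc]
  refine pow_dvd_sum_of_perm (k := m + c) σ ?_ f ?_ ?_
  · ext t i
    rw [hσ, ← hq, ZMod.natCast_self, add_zero, Equiv.Perm.one_apply]
  · intro t
    have hs : ∀ i, σ t i = t (i + 1) := fun i => by simpa using hσ 1 t i
    have h1 : seqProd (fun i => σ t i) q = (t 0)⁻¹ * seqProd (fun i => t i) q * t 0 := by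
      have := seqProd_shift (fun i => t i) q (by simp)
      simpa [hs] using this
    have h2 : IsConj y (seqProd (fun i => σ t i) q) ↔ IsConj y (seqProd (fun i => t i) q) := by
      have h3 : IsConj (seqProd (fun i => t i) q) (seqProd (fun i => σ t i) q) := by
        rw [h1]
        exact isConj_iff.2 ⟨(t 0)⁻¹, by simp⟩
      exact ⟨fun h => h.trans h3.symm, fun h => h.trans h3⟩
    have h4 : ∏ i, w.coeff (σ t i) = ∏ i, w.coeff (t i) := by
      simp only [hs]
      exact Equiv.prod_comp (Equiv.addRight (1 : ZMod q)) (fun i => w.coeff (t i))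
    simp only [f, h2, h4]
  · intro t ht hfix
    have hconj : IsConj y (seqProd (fun i => t i) q) := by
      by_contra h
      exact ht (if_neg h)
    refine hy ((isPRegular_conj p hconj).2 ?_)
    have hper := seqProd_mul_of_periodic (fun i => t i) (p ^ m) (p ^ c) (by
      intro i
      have := congrFun hfix i
      rw [hσ] at this
      simpa using this)
    have hper' : seqProd (fun i => t i) q = seqProd (fun i => t i) (p ^ m) ^ p ^ c := by
      rw [← hper, ← pow_add]
    rw [hper']
    exact isPRegular_pow p _ le_rfl dvd_rfl

end CyclicSums

/-! ### Divisibility by powers of `p` in integral extensions of `ℤ` -/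

section Arithmetic

variable {R : Type*} [CommRing R]

theorem int_not_mem_of_not_dvd {p : ℕ} [Fact p.Prime] {M : Ideal R} [M.IsPrime]
    (hM : (p : R) ∈ M) {N : ℤ} (hN : ¬ (p : ℤ) ∣ N) : (N : R) ∉ M := by
  intro h
  have hco : IsCoprime (p : ℤ) N :=
    ((Nat.prime_iff_prime_int.1 (Fact.out : p.Prime)).coprime_iff_not_dvd).2 hN
  obtain ⟨u, v, huv⟩ := hco
  refine ‹M.IsPrime›.ne_top ((Ideal.eq_top_iff_one M).2 ?_)
  have := M.add_mem (M.mul_mem_left (u : R) hM) (M.mul_mem_left (v : R) h)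
  have h2 := congrArg (Int.cast : ℤ → R) huv
  push_cast at h2
  rwa [h2] at this

/-- The localization of an integral extension of `ℤ` at a prime above `p` has no nonzero element
that is infinitely divisible by `p`. -/
theorem eq_zero_of_forall_pow_dvd [IsDomain R] [CharZero R] [Algebra.IsIntegral ℤ R]
    {p : ℕ} [Fact p.Prime] {M : Ideal R} [M.IsPrime] (hM : (p : R) ∈ M) (a : R)
    (h : ∀ k : ℕ, ∃ s ∉ M, (p : R) ^ k ∣ s * a) : a = 0 := by
  by_contra ha
  -- An integral element `a ≠ 0` has a nonzero integer multiple `N`. One power of `p` more than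
  -- divides `N` yields a contradiction.
  obtain ⟨N, hN, hN0⟩ := Submodule.exists_mem_ne_zero_of_ne_bot
    (Ideal.comap_ne_bot_of_integral_mem (R := ℤ) ha (Ideal.mem_span_singleton_self a)
      (Algebra.IsIntegral.isIntegral a))
  rw [Ideal.mem_comap, Ideal.mem_span_singleton, algebraMap_int_eq, eq_intCast] at hN
  obtain ⟨c, hc⟩ := hN
  have hp : p.Prime := Fact.out
  have hfin : FiniteMultiplicity (p : ℤ) N :=
    Int.finiteMultiplicity_iff.2 ⟨by simpa using hp.ne_one, hN0⟩
  obtain ⟨N', hN', hpN'⟩ := hfin.exists_eq_pow_mul_and_not_dvd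
  obtain ⟨s, hs, b, hb⟩ := h (multiplicity (p : ℤ) N + 1)
  have hpR : (p : R) ≠ 0 := Nat.cast_ne_zero.2 hp.ne_zero
  have key : s * (N' : R) = p * (b * c) := by
    refine mul_left_cancel₀ (pow_ne_zero (multiplicity (p : ℤ) N) hpR) ?_
    have h1 := congrArg (Int.cast : ℤ → R) hN'
    push_cast at h1
    rw [mul_left_comm, ← h1, hc, ← mul_assoc, hb]
    ring
  have hmem : s * (N' : R) ∈ M := key ▸ M.mul_mem_right _ hM
  rcases ‹M.IsPrime›.mem_or_mem hmem with h1 | h1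
  · exact hs h1
  · exact int_not_mem_of_not_dvd hM hpN' h1

theorem exists_isIdempotentElem_pow_of_finite {S : Type*} [Monoid S] [Finite S] (x : S) :
    ∃ t, 0 < t ∧ IsIdempotentElem (x ^ t) := by
  obtain ⟨i, j, hij, h⟩ : ∃ i j, i < j ∧ x ^ i = x ^ j := by
    obtain ⟨i, j, hne, h⟩ := Finite.exists_ne_map_eq_of_infinite (fun n : ℕ => x ^ n)
    rcases lt_or_gt_of_ne hne with h1 | h1
    · exact ⟨i, j, h1, h⟩
    · exact ⟨j, i, h1, h.symm⟩
  obtain ⟨d, rfl⟩ := Nat.exists_eq_add_of_lt hij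
  have hstep : ∀ n r, i ≤ n → x ^ (n + (d + 1) * r) = x ^ n := by
    intro n r hn
    obtain ⟨e, rfl⟩ := Nat.exists_eq_add_of_le hn
    induction r with
    | zero => simp
    | succ r ih =>
      rw [← ih, show i + e + (d + 1) * (r + 1) = (i + d + 1) + (e + (d + 1) * r) by ring,
        pow_add, ← h, ← pow_add, add_assoc]
  -- Powers are periodic with period `d + 1` from exponent `i` on; this exponent is a multiple of
  -- the period and at least `i`.
  refine ⟨(d + 1) * (i + 1), by positivity, ?_⟩
  rw [IsIdempotentElem, ← pow_add]
  exact hstep _ _ (by nlinarith)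

/-- Modulo `p`, the subring generated by `x` is finitely generated over `ℤ` and killed by `p`, hence
finite, and some positive power of an element of a finite monoid is idempotent. -/
theorem exists_pow_isIdempotentElem_mod [Algebra.IsIntegral ℤ R] (p : ℕ) [Fact p.Prime] (x : R) :
    ∃ t, 0 < t ∧ IsIdempotentElem (Ideal.Quotient.mk (Ideal.span {(p : R)}) x ^ t) := by
  set Q := R ⧸ Ideal.span {(p : R)}
  set y : Q := Ideal.Quotient.mk _ x
  have hpQ : (p : Q) = 0 := by
    rw [← map_natCast (Ideal.Quotient.mk (Ideal.span {(p : R)}))]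
    exact Ideal.Quotient.eq_zero_iff_mem.2 (Ideal.mem_span_singleton_self _)
  have hy : IsIntegral ℤ y := (Algebra.IsIntegral.isIntegral (R := ℤ) x).map
    (Ideal.Quotient.mk (Ideal.span {(p : R)})).toIntAlgHom
  let A := Algebra.adjoin ℤ {y}
  have : Module.Finite ℤ A := Module.Finite.of_fg hy.fg_adjoin_singleton
  have : Finite A := Module.finite_of_fg_torsion A fun z =>
    ⟨⟨p, mem_nonZeroDivisors_of_ne_zero
      (Int.natCast_ne_zero.2 (Fact.out : p.Prime).ne_zero)⟩, Subtype.ext (by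
        change (p : ℤ) • (z : Q) = 0
        rw [zsmul_eq_mul, Int.cast_natCast, hpQ, zero_mul])⟩
  obtain ⟨t, ht, h⟩ := exists_isIdempotentElem_pow_of_finite
    (⟨y, Algebra.self_mem_adjoin_singleton ℤ y⟩ : A)
  exact ⟨t, ht, congrArg Subtype.val h⟩

theorem exists_forall_isIdempotentElem_mod [Algebra.IsIntegral ℤ R] (p : ℕ) [Fact p.Prime]
    {ι : Type*} (s : Finset ι) (x : ι → R) :
    ∃ t, 0 < t ∧ ∀ i ∈ s, (p : R) ∣ (x i ^ t) ^ 2 - x i ^ t := by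
  classical
  suffices h : ∃ t, 0 < t ∧
      ∀ i ∈ s, IsIdempotentElem (Ideal.Quotient.mk (Ideal.span {(p : R)}) (x i) ^ t) by
    obtain ⟨t, ht, h⟩ := h
    refine ⟨t, ht, fun i hi => ?_⟩
    have := h i hi
    rw [← Ideal.mem_span_singleton, ← Ideal.Quotient.eq, map_pow, map_pow, sq]
    exact this
  induction s using Finset.induction_on with
  | empty => exact ⟨1, one_pos, by simp⟩
  | insert j s _ ih =>
    obtain ⟨t, ht, h⟩ := ih
    obtain ⟨u, hu, hj⟩ := exists_pow_isIdempotentElem_mod p (x j)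
    refine ⟨t * u, Nat.mul_pos ht hu, fun i hi => ?_⟩
    rcases mem_insert.1 hi with rfl | hi
    · rw [mul_comm, pow_mul]; exact hj.pow t
    · rw [pow_mul]; exact (h i hi).pow u

/-- Raising a congruence mod `p` to the power `p ^ k` makes it hold mod `p ^ (k + 1)`; here an
idempotent mod `p` is lifted. -/
theorem pow_succ_dvd_sq_sub (p : ℕ) [Fact p.Prime] {x : R} (h : (p : R) ∣ x ^ 2 - x) (k : ℕ) :
    (p : R) ^ (k + 1) ∣ (x ^ p ^ k) ^ 2 - x ^ p ^ k := by
  rw [← pow_mul, mul_comm, pow_mul]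
  exact dvd_sub_pow_of_dvd_sub h k

end Arithmetic

/-! ### Block orthogonality between p-regular and p-singular elements -/

section BlockOrthogonality

variable {G : Type*} [Group G] [Fintype G]

theorem trace_lift_eq_sum {n : ℕ} (ρ : Representation ℂ G (Fin n → ℂ))
    (w : MonoidAlgebra (integralClosure ℤ ℂ) G) :
    LinearMap.trace ℂ _ (MonoidAlgebra.lift (integralClosure ℤ ℂ) (End ℂ (Fin n → ℂ)) G ρ w)
      = ∑ g, (w.coeff g : ℂ) * ρ.character g := by
  rw [MonoidAlgebra.lift_apply, Finsupp.sum_fintype _ _ (by simp), map_sum]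
  refine sum_congr rfl fun g _ => ?_
  rw [show w.coeff g • ρ g = (w.coeff g : ℂ) • ρ g from rfl, map_smul, smul_eq_mul]
  rfl

variable {M : Ideal (integralClosure ℤ ℂ)}

omit [Fintype G] in
theorem SameBlock.refl (χ : G → ℂ) : SameBlock M χ χ := fun _ => ⟨0, M.zero_mem, by simp⟩

omit [Fintype G] in
theorem SameBlock.symm {χ ψ : G → ℂ} (h : SameBlock M χ ψ) : SameBlock M ψ χ := fun g => by
  obtain ⟨m, hm, h⟩ := h g
  exact ⟨-m, M.neg_mem hm, by push_cast; rw [h]; ring⟩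

omit [Fintype G] in
theorem SameBlock.trans {χ ψ φ : G → ℂ} (h : SameBlock M χ ψ) (h' : SameBlock M ψ φ) :
    SameBlock M χ φ := fun g => by
  obtain ⟨m, hm, h⟩ := h g
  obtain ⟨m', hm', h'⟩ := h' g
  exact ⟨m + m', M.add_mem hm hm', by push_cast; rw [h, h']; ring⟩

namespace Block

omit [Fintype G] in
theorem sameBlock (B : Block M G) {χ ψ : G → ℂ} (hχ : χ ∈ B.irr) (hψ : ψ ∈ B.irr) :
    SameBlock M χ ψ := by
  obtain ⟨φ, -, h⟩ := B.exists_eq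
  rw [h] at hχ hψ
  exact hχ.2.symm.trans hψ.2

omit [Fintype G] in
theorem not_sameBlock (B : Block M G) {χ ψ : G → ℂ} (hχ : χ ∈ B.irr) (hψ : ψ ∈ Irr G)
    (hψB : ψ ∉ B.irr) : ¬ SameBlock M χ ψ := by
  obtain ⟨φ, -, h⟩ := B.exists_eq
  rw [h] at hχ hψB
  exact fun hs => hψB ⟨hψ, hχ.2.trans hs⟩

omit [Fintype G] in
theorem nonempty_irr (B : Block M G) : B.irr.Nonempty := by
  obtain ⟨φ, hφ, h⟩ := B.exists_eq
  exact ⟨φ, h ▸ ⟨hφ, SameBlock.refl φ⟩⟩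

end Block

-- A substitute for the block idempotent with coefficients in the algebraic integers: it acts by
-- scalars that are units at `M` on `B` and zero on `S`. Each `ψ ∈ S` contributes a factor, a class
-- sum on which `ψ` and `B` differ mod `M`, minus its value at `ψ`.
open scoped Classical in
theorem exists_central_elem_avoiding [M.IsPrime] (B : Block M G) (S : Finset (G → ℂ))
    (hS : ∀ ψ ∈ S, ψ ∈ Irr G ∧ ψ ∉ B.irr) :
    ∃ (a : MonoidAlgebra (integralClosure ℤ ℂ) G) (α : (G → ℂ) → integralClosure ℤ ℂ),
      (∀ (n : ℕ) (ρ : Representation ℂ G (Fin n → ℂ)), ρ.IsIrreducible →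
        MonoidAlgebra.lift (integralClosure ℤ ℂ) (End ℂ (Fin n → ℂ)) G ρ a
          = (α ρ.character : ℂ) • 1) ∧
      (∀ χ ∈ B.irr, α χ ∉ M) ∧ ∀ ψ ∈ S, α ψ = 0 := by
  induction S using Finset.induction_on with
  | empty =>
    refine ⟨1, 1, ?_, ?_, by simp⟩
    · intro n ρ hρ; simp
    · intro χ _ h; exact ‹M.IsPrime›.ne_top ((Ideal.eq_top_iff_one M).2 h)
  | insert ψ S _ ih =>
    obtain ⟨a, α, h1, h2, h3⟩ := ih fun φ hφ => hS φ (mem_insert_of_mem hφ)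
    obtain ⟨hψ, hψB⟩ := hS ψ (mem_insert_self _ _)
    obtain ⟨χ₀, hχ₀⟩ := B.nonempty_irr
    have hne := B.not_sameBlock hχ₀ hψ hψB
    unfold SameBlock at hne
    push Not at hne
    obtain ⟨h, hh⟩ := hne
    let ω : (G → ℂ) → integralClosure ℤ ℂ := fun χ =>
      if hχ : χ ∈ Irr G then ⟨centralChar χ h, isIntegral_centralChar hχ h⟩ else 0
    have hω : ∀ χ ∈ Irr G, (ω χ : ℂ) = centralChar χ h := fun χ hχ => by simp [ω, hχ]
    refine ⟨(∑ k with IsConj h k, MonoidAlgebra.of _ G k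
      - algebraMap _ _ (ω ψ)) * a, fun χ => (ω χ - ω ψ) * α χ, ?_, ?_, ?_⟩
    · intro n ρ hρ
      rw [map_mul, h1 n ρ hρ, map_sub, map_sum]
      simp only [MonoidAlgebra.lift_of, AlgHom.commutes]
      rw [sum_class_eq_centralChar, ← hω _ ⟨n, ρ, hρ, rfl⟩, Algebra.algebraMap_eq_smul_one,
        show ω ψ • (1 : End ℂ (Fin n → ℂ)) = (ω ψ : ℂ) • 1 from rfl]
      refine LinearMap.ext fun v => ?_
      simp [sub_smul, mul_smul, sub_mul]
      module
    · intro χ hχ hmem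
      rcases ‹M.IsPrime›.mem_or_mem hmem with h4 | h4
      · obtain ⟨m, hm, hm'⟩ := B.sameBlock hχ₀ hχ h
        refine hh (m + (ω χ - ω ψ)) (M.add_mem hm h4) ?_
        push_cast
        rw [hm', hω _ (B.irr_subset hχ), hω _ hψ]
        ring
      · exact h2 χ hχ h4
    · intro φ hφ
      rcases mem_insert.1 hφ with rfl | hφ
      · simp
      · simp [h3 φ hφ]

omit [Fintype G] in
theorem pow_eq_self_of_isPRegular (p : ℕ) [Fact p.Prime] {x : G} (hx : IsPRegular p x) (j : ℕ) :
    x ^ p ^ ((orderOf x).totient * j) = x := by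
  have hco : Nat.Coprime p (orderOf x) := ((Fact.out : p.Prime).coprime_iff_not_dvd).2 hx
  have h1 : p ^ ((orderOf x).totient * j) ≡ 1 [MOD orderOf x] := by
    rw [pow_mul]; simpa using (Nat.ModEq.pow_totient hco).pow j
  conv_rhs => rw [← pow_one x]
  exact pow_eq_pow_iff_modEq.2 h1

-- The sum, multiplied by the class size `K`, is shown to be divisible by every power of `p` locally
-- at `M`. With `a` as in `exists_central_elem_avoiding`, the coefficients of a large power of `a ^
-- t * x` over the class of `z = y⁻¹` are computed twice: by counting tuples the sum is highly
-- divisible by `p`, and by column orthogonality it is the block sum weighted by scalars `β χ`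
-- nearly idempotent p-adically.
open scoped Classical in
theorem block_orthogonality (p : ℕ) [Fact p.Prime] [M.IsPrime]
    (hM : (p : integralClosure ℤ ℂ) ∈ M) (B : Block M G) {x y : G} (hx : IsPRegular p x)
    (hy : ¬ IsPRegular p y) : ∑ χ : B.irr, (χ : G → ℂ) x * (χ : G → ℂ) y = 0 := by
  obtain ⟨z, rfl⟩ : ∃ z, y = z⁻¹ := ⟨y⁻¹, by simp⟩
  rw [isPRegular_inv] at hy
  obtain ⟨a, α, ha, hαB, hα0⟩ := exists_central_elem_avoiding B
    ((irrFinset G).filter (· ∉ B.irr)) (by simp)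
  obtain ⟨t, ht, hidem⟩ := exists_forall_isIdempotentElem_mod p (univ : Finset B.irr)
    (fun χ => α χ)
  let cf : B.irr → integralClosure ℤ ℂ := fun χ =>
    ⟨(χ : G → ℂ) x * (χ : G → ℂ) z⁻¹, (isIntegral_irr (B.irr_subset χ.2) x).mul
      (isIntegral_irr (B.irr_subset χ.2) z⁻¹)⟩
  set K : ℕ := Nat.card (conjugatesOf z) with hK
  have hK0 : (K : ℂ) ≠ 0 := by
    have : Nonempty (conjugatesOf z) := ⟨⟨z, mem_conjugatesOf_self⟩⟩
    exact Nat.cast_ne_zero.2 Nat.card_pos.ne'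
  set c := (Nat.card G).factorization p
  have hmain : (K : integralClosure ℤ ℂ) * ∑ χ, cf χ = 0 := by
    refine eq_zero_of_forall_pow_dvd hM _ fun k => ?_
    -- Choosing `m + c` as a multiple of `φ(orderOf x)` gives `p ^ (m + c) ≡ 1` modulo the order of
    -- `x`, by Euler's theorem.
    obtain ⟨m, hkm, hm⟩ : ∃ m, k ≤ m ∧ x ^ p ^ (m + c) = x := by
      have hpos : 0 < (orderOf x).totient := Nat.totient_pos.2 (orderOf_pos x)
      refine ⟨(orderOf x).totient * (k + c) - c, ?_, ?_⟩
      · have : k + c ≤ (orderOf x).totient * (k + c) := Nat.le_mul_of_pos_left _ hpos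
        omega
      · rw [Nat.sub_add_cancel, pow_eq_self_of_isPRegular p hx]
        have : k + c ≤ (orderOf x).totient * (k + c) := Nat.le_mul_of_pos_left _ hpos
        omega
    set β : B.irr → integralClosure ℤ ℂ := fun χ => (α χ ^ t) ^ p ^ (m + c) with hβ
    let w := a ^ t * MonoidAlgebra.of (integralClosure ℤ ℂ) G x
    have hdvd := pow_dvd_sum_coeff_pow p w z hy m
    have hval : (Nat.card G : integralClosure ℤ ℂ) * ∑ g with IsConj z g, (w ^ p ^ (m + c)).coeff g
        = K * ∑ χ, cf χ * β χ := by
      apply Subtype.ext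
      push_cast
      have h1 : (Nat.card G : ℂ) * ∑ g with IsConj z g, ((w ^ p ^ (m + c)).coeff g : ℂ)
          = K * ∑ χ ∈ irrFinset G, χ z⁻¹ * ∑ g, ((w ^ p ^ (m + c)).coeff g : ℂ) * χ g := by
        rw [sum_filter, mul_sum]
        calc _ = ∑ g, ((w ^ p ^ (m + c)).coeff g : ℂ)
                * (K * ∑ χ ∈ irrFinset G, χ z⁻¹ * χ g) := by
              refine sum_congr rfl fun g _ => ?_
              rw [← card_mul_indicator_eq_sum]
              split_ifs <;> ring
          _ = _ := by
              simp only [mul_sum]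
              rw [sum_comm]
              refine sum_congr rfl fun χ _ => sum_congr rfl fun g _ => by ring
      have h2 : ∀ χ ∈ Irr G, ∑ g, ((w ^ p ^ (m + c)).coeff g : ℂ) * χ g
          = ((α χ : ℂ) ^ t) ^ p ^ (m + c) * χ x := by
        rintro χ ⟨n, ρ, hρ, rfl⟩
        -- Since `a` acts as a scalar, the power of `a ^ t * x` acts as a scalar power times `ρ (x ^
        -- p ^ (m + c)) = ρ x`.
        have h3 : MonoidAlgebra.lift (integralClosure ℤ ℂ) (End ℂ (Fin n → ℂ)) G ρ
            (w ^ p ^ (m + c)) = ((α ρ.character : ℂ) ^ t) ^ p ^ (m + c) • ρ x := by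
          rw [map_pow, map_mul, map_pow, ha n ρ hρ, MonoidAlgebra.lift_of,
            smul_pow, one_pow, smul_one_mul, smul_pow, ← map_pow, hm]
        rw [← trace_lift_eq_sum, h3, map_smul]
        rfl
      refine Eq.trans ?_ (h1.trans ?_)
      · simp
      · congr 1
        rw [← sum_filter_add_sum_filter_not (irrFinset G) (· ∈ B.irr)]
        rw [sum_eq_zero (s := (irrFinset G).filter (· ∉ B.irr)), add_zero]
        · symm
          refine Eq.trans (b := ∑ χ : B.irr, (χ : G → ℂ) x * (χ : G → ℂ) z⁻¹ *
            ((α χ : ℂ) ^ t) ^ p ^ (m + c)) ?_ ?_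
          · simp [cf, hβ]
          · rw [Finset.sum_subtype (p := (· ∈ B.irr)) _ (fun χ => by
              simpa using fun h => B.irr_subset h)]
            refine sum_congr rfl fun χ _ => ?_
            rw [h2 χ (B.irr_subset χ.2)]
            ring
        · intro χ hχ
          rw [h2 χ (mem_irrFinset.1 (mem_filter.1 hχ).1), hα0 χ hχ]
          simp [ht.ne', (Fact.out : p.Prime).ne_zero]
    -- The multiplier outside `M` is the product of all `β χ`: as `β χ * (1 - β χ)` is divisible by
    -- `p ^ k`, multiplying by it makes each weight `β χ` replaceable by 1 mod `p ^ k`.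
    refine ⟨∏ χ, β χ, ?_, ?_⟩
    · intro hmem
      obtain ⟨χ, -, h⟩ := ‹M.IsPrime›.prod_mem_iff.1 hmem
      exact hαB χ χ.2 (‹M.IsPrime›.mem_of_pow_mem _ (‹M.IsPrime›.mem_of_pow_mem _ h))
    · have h1 : (p : integralClosure ℤ ℂ) ^ k ∣ K * ∑ χ, cf χ * β χ :=
        hval ▸ Dvd.dvd.mul_left ((pow_dvd_pow _ (by omega)).trans hdvd) _
      have h2 : ∀ χ, (p : integralClosure ℤ ℂ) ^ k ∣ (∏ χ, β χ) * (1 - β χ) := by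
        intro χ
        have h3 := pow_succ_dvd_sq_sub p (hidem χ (mem_univ _)) (m + c)
        have h4 : (p : integralClosure ℤ ℂ) ^ k ∣ β χ * (1 - β χ) := by
          have h5 := (pow_dvd_pow (p : integralClosure ℤ ℂ)
            (show k ≤ m + c + 1 by omega)).trans h3
          have h6 : β χ * (1 - β χ) = -(β χ ^ 2 - β χ) := by ring
          rw [h6]
          exact (dvd_neg).2 h5
        rw [← mul_prod_erase univ β (mem_univ χ), mul_right_comm]
        exact h4.mul_right _
      have h3 : (∏ χ, β χ) * (K * ∑ χ, cf χ) = (∏ χ, β χ) * (K * ∑ χ, cf χ * β χ)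
          + ∑ χ, K * cf χ * ((∏ χ, β χ) * (1 - β χ)) := by
        simp only [mul_sum]
        rw [← sum_add_distrib]
        exact sum_congr rfl fun χ _ => by ring
      rw [h3]
      exact dvd_add (h1.mul_left _) (dvd_sum fun χ _ => (h2 χ).mul_left _)
  have h := congrArg (Subtype.val) hmain
  push_cast at h
  have h' := (mul_eq_zero.1 h).resolve_left hK0
  simpa [cf] using h'

end BlockOrthogonality

/-! ### Separating sets of characters are unions of blocks -/

section Separation

variable {G : Type*} [Group G] [Fintype G]

open scoped Classical in
theorem sum_eq_sum_conjClasses {A : Type*} [CommRing A] (F : G → A)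
    (hF : ∀ g h, IsConj g h → F g = F h) :
    ∑ g, F g = ∑ c : ConjClasses G, (Nat.card (conjugatesOf c.out) : A) * F c.out := by
  rw [← sum_fiberwise univ (fun g => ConjClasses.mk g) F]
  refine sum_congr rfl fun c _ => ?_
  have hc : ConjClasses.mk c.out = c := Quotient.out_eq c
  have hiff : ∀ g, ConjClasses.mk g = c ↔ IsConj c.out g := fun g => by
    conv_lhs => rw [← hc]
    rw [ConjClasses.mk_eq_mk_iff_isConj, isConj_comm]
  rw [sum_congr rfl (g := fun _ => F c.out), sum_const, card_conjugatesOf, nsmul_eq_mul]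
  · simp only [hiff]
  · intro g hg
    exact (hF _ _ ((hiff g).1 (mem_filter.1 hg).2)).symm

omit [Fintype G] in
theorem card_conjugatesOf_mul_card_centralizer (g : G) :
    Nat.card (conjugatesOf g) * Nat.card (Subgroup.centralizer {g}) = Nat.card G := by
  have h := Subgroup.card_mul_index (MulAction.stabilizer (ConjAct G) g)
  rw [MulAction.index_stabilizer, ConjAct.orbit_eq_carrier_conjClasses] at h
  rw [Subgroup.nat_card_centralizer_nat_card_stabilizer, mul_comm]
  exact h

theorem isIntegral_of_coprime_mul {a b : ℕ} (hab : a.Coprime b) {z : ℂ}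
    (ha : IsIntegral ℤ ((a : ℂ) * z)) (hb : IsIntegral ℤ ((b : ℂ) * z)) : IsIntegral ℤ z := by
  obtain ⟨u, v, huv⟩ := Nat.isCoprime_iff_coprime.2 hab
  have h : z = u * (a * z) + v * (b * z) := by
    have h2 := congrArg (Int.cast : ℤ → ℂ) huv
    push_cast at h2
    linear_combination (-z) * h2
  rw [h]
  exact ((isIntegral_algebraMap (R := ℤ) (x := u)).mul ha).add
    ((isIntegral_algebraMap (R := ℤ) (x := v)).mul hb)

theorem isIntegral_natCast (n : ℕ) : IsIntegral ℤ (n : ℂ) := by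
  simpa using isIntegral_algebraMap (R := ℤ) (A := ℂ) (x := n)

/-- The `p`-part of `|G|`. -/
noncomputable def groupPPart (p : ℕ) (G : Type*) [Group G] : ℕ :=
  p ^ (Nat.card G).factorization p

/-- The `p'`-part of `|G|`. -/
noncomputable def groupPPrimePart (p : ℕ) (G : Type*) [Group G] : ℕ :=
  Nat.card G / groupPPart p G

omit [Fintype G] in
theorem groupPPart_mul (p : ℕ) (G : Type*) [Group G] :
    groupPPart p G * groupPPrimePart p G = Nat.card G := Nat.ordProj_mul_ordCompl_eq_self _ p

theorem groupPPrimePart_coprime (p : ℕ) [Fact p.Prime] (G : Type*) [Group G] [Finite G] (e : ℕ) :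
    (groupPPrimePart p G).Coprime (p ^ e) :=
  (Nat.coprime_ordCompl Fact.out Nat.card_pos.ne').symm.pow_right e

theorem groupPPart_ne_zero (p : ℕ) [hp : Fact p.Prime] (G : Type*) [Group G] :
    (groupPPart p G : ℂ) ≠ 0 :=
  Nat.cast_ne_zero.2 (pow_pos hp.out.pos _).ne'

omit [Fintype G] in
theorem isPRegular_one (p : ℕ) [hp : Fact p.Prime] : IsPRegular p (1 : G) := by
  unfold IsPRegular
  rw [orderOf_one]
  exact hp.out.one_lt.ne' ∘ Nat.dvd_one.1

/-- A set of irreducible characters whose partial sums `∑ χ(g) χ(h)` separate `p`-regular from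
`p`-singular elements. -/
structure IsSeparating (p : ℕ) (S : Finset (G → ℂ)) : Prop where
  irr : ∀ χ ∈ S, χ ∈ Irr G
  sep : ∀ g u : G, IsPRegular p g → ¬ IsPRegular p u → ∑ χ ∈ S, χ g * χ u = 0

variable {p : ℕ} [Fact p.Prime] {S : Finset (G → ℂ)}

/-- The integer `n` is the dimension of the `P`-fixed vectors. -/
theorem exists_sum_subgroup_eq {χ : G → ℂ} (hχ : χ ∈ Irr G) (P : Subgroup G) [Fintype P] :
    ∃ n : ℕ, ∑ u : P, χ u = Nat.card P * n := by
  obtain ⟨d, ρ, hρ, rfl⟩ := hχ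
  have hP : (Nat.card P : ℂ) ≠ 0 := Nat.cast_ne_zero.2 Nat.card_pos.ne'
  have : Invertible (Nat.card P : ℂ) := invertibleOfNonzero hP
  have h := Representation.card_inv_mul_sum_char_eq_finrank (ρ.comp P.subtype)
  refine ⟨finrank ℂ (Representation.invariants (ρ.comp P.subtype)), ?_⟩
  rw [← h, mul_inv_cancel_left₀ hP]
  rfl

/-- For p-regular `g`, sum `∑ χ g * χ u` over `u` in a Sylow p-subgroup `P`: only `u = 1` survives,
while `∑ χ u` is a multiple of `|P|` for each `χ`. For p-singular `g` the sum is zero. -/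
theorem IsSeparating.isIntegral_div (hS : IsSeparating p S) (g : G) :
    IsIntegral ℤ ((∑ χ ∈ S, χ 1 * χ g) / groupPPart p G) := by
  classical
  by_cases hg : IsPRegular p g
  · obtain ⟨P⟩ : Nonempty (Sylow p G) := inferInstance
    have hP : Nat.card P = groupPPart p G := P.card_eq_multiplicity
    have h1 : ∑ u : P, ∑ χ ∈ S, χ g * χ u = ∑ χ ∈ S, χ 1 * χ g := by
      rw [sum_eq_single (1 : (P : Subgroup G)) ?_ (fun h => absurd (mem_univ _) h)]
      · exact sum_congr rfl fun χ _ => mul_comm _ _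
      · intro u _ hu
        refine hS.sep g u hg fun hreg => hu ?_
        obtain ⟨k, hk⟩ := P.isPGroup' u
        have h2 : orderOf (u : G) ∣ p ^ k := by
          rw [orderOf_dvd_iff_pow_eq_one]
          exact_mod_cast congrArg Subtype.val hk
        obtain ⟨j, -, hj⟩ := (Nat.dvd_prime_pow (Fact.out : p.Prime)).1 h2
        unfold IsPRegular at hreg
        rw [hj] at hreg
        have hj0 : j = 0 := by
          by_contra h0
          exact hreg (dvd_pow_self p h0)
        rw [hj0, pow_zero, orderOf_eq_one_iff] at hj
        exact Subtype.ext hj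
    have h2 : ∀ χ : S, ∃ n : ℕ, ∑ u : P, (χ : G → ℂ) u = groupPPart p G * n := fun χ => by
      obtain ⟨n, hn⟩ := exists_sum_subgroup_eq (hS.irr χ χ.2) (P : Subgroup G)
      exact ⟨n, hn.trans (by rw [← hP])⟩
    choose n hn using h2
    rw [← h1, sum_comm, sum_div, ← sum_coe_sort]
    refine IsIntegral.sum _ fun χ _ => ?_
    rw [← mul_sum, hn, mul_left_comm, mul_div_cancel_left₀ _ (groupPPart_ne_zero p G)]
    exact (isIntegral_irr (hS.irr χ χ.2) g).mul (isIntegral_natCast _)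
  · rw [hS.sep 1 g (isPRegular_one p) hg, zero_div]
    exact isIntegral_zero

-- By `sum_class_irr_mul`, the class size of `h` times the sum is a sum of terms covered by
-- `IsSeparating.isIntegral_div`, hence divisible by `|G|_p`. This gives integrality up to a factor
-- prime to `p`; the p-power factor is trivial, and the two combine by Bézout.
open scoped Classical in
theorem IsSeparating.isIntegral_div_centralizer (hS : IsSeparating p S) (g h : G) :
    IsIntegral ℤ ((∑ χ ∈ S, χ g * χ h) / centralizerPPart p h) := by
  set e := (Nat.card (Subgroup.centralizer {h})).factorization p
  have hp : p.Prime := Fact.out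
  have hc : (centralizerPPart p h : ℂ) ≠ 0 := Nat.cast_ne_zero.2 (pow_pos hp.pos _).ne'
  refine isIntegral_of_coprime_mul (groupPPrimePart_coprime p G e) ?_ ?_
  · have h1 : (Nat.card (conjugatesOf h) : ℂ) * (∑ χ ∈ S, χ g * χ h)
        = ∑ k with IsConj h k, ∑ χ ∈ S, χ 1 * χ (k * g) := by
      rw [sum_comm, mul_sum]
      refine sum_congr rfl fun χ hχ => ?_
      rw [← mul_sum, sum_class_irr_mul (hS.irr χ hχ), centralChar]
      field_simp [irr_one_ne_zero (hS.irr χ hχ)]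
    obtain ⟨m', hm'⟩ := Nat.ordProj_dvd (Nat.card (Subgroup.centralizer {h})) p
    have hcard : (groupPPart p G : ℂ) * groupPPrimePart p G
        = Nat.card (conjugatesOf h) * (centralizerPPart p h * m') := by
      rw [← Nat.cast_mul, groupPPart_mul, ← card_conjugatesOf_mul_card_centralizer h, hm']
      push_cast [centralizerPPart]
      rfl
    have hν := groupPPart_ne_zero p G
    have h2 : (groupPPrimePart p G : ℂ) * ((∑ χ ∈ S, χ g * χ h) / centralizerPPart p h)
        = m' * ((∑ k with IsConj h k, ∑ χ ∈ S, χ 1 * χ (k * g)) / groupPPart p G) := by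
      rw [← h1]
      field_simp
      linear_combination (∑ χ ∈ S, χ g * χ h) * hcard
    rw [h2, sum_div]
    exact (isIntegral_natCast _).mul (IsIntegral.sum _ fun k _ => hS.isIntegral_div _)
  · rw [show ((p ^ e : ℕ) : ℂ) = centralizerPPart p h from rfl, mul_div_cancel₀ _ hc]
    exact IsIntegral.sum _ fun χ hχ =>
      (isIntegral_irr (hS.irr χ hχ) g).mul (isIntegral_irr (hS.irr χ hχ) h)

-- The left side is the central character of `χ` evaluated at `|G|_{p'} e_S`, where `e_S` is the sum
-- of the central idempotents of the characters in `S`.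
open scoped Classical in
theorem IsSeparating.sum_conjClasses (hS : IsSeparating p S) {χ : G → ℂ} (hχ : χ ∈ Irr G) :
    ∑ c : ConjClasses G, (∑ φ ∈ S, φ 1 * φ c.out⁻¹) / groupPPart p G * centralChar χ c.out
      = if χ ∈ S then (groupPPrimePart p G : ℂ) else 0 := by
  have hν := groupPPart_ne_zero p G
  have hN : (Nat.card G : ℂ) ≠ 0 := Nat.cast_ne_zero.2 (Nat.card_pos (α := G)).ne'
  have h1 := sum_eq_sum_conjClasses (fun g => (∑ φ ∈ S, φ 1 * φ g⁻¹) * χ g) (by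
    intro g h hgh
    rw [irr_conj hχ hgh]
    congr 1
    exact sum_congr rfl fun φ hφ => by
      rw [irr_conj (hS.irr φ hφ) (isConj_inv_inv hgh)])
  have h2 : ∑ g, (∑ φ ∈ S, φ 1 * φ g⁻¹) * χ g = if χ ∈ S then Nat.card G * χ 1 else 0 := by
    have h3 : ∑ g, (∑ φ ∈ S, φ 1 * φ g⁻¹) * χ g
        = ∑ φ ∈ S, φ 1 * (Nat.card G * scalarProd χ φ) := by
      simp only [scalarProd, mul_inv_cancel_left₀ hN, sum_mul, mul_sum]
      rw [sum_comm]
      exact sum_congr rfl fun φ _ => sum_congr rfl fun g _ => by ring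
    rw [h3]
    split_ifs with h
    · rw [sum_eq_single χ, scalarProd_irr hχ hχ, if_pos rfl]
      · ring
      · intro φ hφ hne
        rw [scalarProd_irr hχ (hS.irr φ hφ), if_neg hne.symm]; simp
      · exact fun hn => absurd h hn
    · refine sum_eq_zero fun φ hφ => ?_
      rw [scalarProd_irr hχ (hS.irr φ hφ), if_neg (fun he : χ = φ => h (he ▸ hφ))]; simp
  have h4 : ∑ c : ConjClasses G,
      (∑ φ ∈ S, φ 1 * φ c.out⁻¹) / groupPPart p G * centralChar χ c.out
      = (∑ g, (∑ φ ∈ S, φ 1 * φ g⁻¹) * χ g) / (groupPPart p G * χ 1) := by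
    rw [h1, sum_div]
    refine sum_congr rfl fun c _ => ?_
    rw [centralChar]
    field_simp [irr_one_ne_zero hχ]
  rw [h4, h2]
  split_ifs
  · rw [← groupPPart_mul p G]
    push_cast
    field_simp [irr_one_ne_zero hχ]
  · simp

/-- A separating set of irreducible characters is a union of blocks. -/
theorem IsSeparating.mem_of_sameBlock {M : Ideal (integralClosure ℤ ℂ)} [M.IsPrime]
    (hM : (p : integralClosure ℤ ℂ) ∈ M) (hS : IsSeparating p S) {χ ψ : G → ℂ}
    (hχ : χ ∈ S) (hψ : ψ ∈ Irr G) (h : SameBlock M χ ψ) : ψ ∈ S := by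
  classical
  by_contra hψS
  choose m hmM hm using h
  have h1 := hS.sum_conjClasses (hS.irr χ hχ)
  have h2 := hS.sum_conjClasses hψ
  rw [if_pos hχ] at h1
  rw [if_neg hψS] at h2
  -- Subtracting the values at `χ` and `ψ`: the coefficients are algebraic integers and the central
  -- characters agree mod `M`, so `|G|_{p'}` would lie in `M`.
  have h3 : ((groupPPrimePart p G : ℤ) : integralClosure ℤ ℂ)
      = ∑ c : ConjClasses G, (⟨_, hS.isIntegral_div c.out⁻¹⟩ : integralClosure ℤ ℂ) * m c.out := by
    apply Subtype.ext
    push_cast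
    rw [← h1, ← sub_zero (∑ c : ConjClasses G, _ * centralChar χ c.out), ← h2,
      ← sum_sub_distrib]
    exact sum_congr rfl fun c _ => by rw [hm, mul_sub]
  refine int_not_mem_of_not_dvd (p := p) hM (N := groupPPrimePart p G) ?_
    (h3 ▸ M.sum_mem fun c _ => M.mul_mem_left _ (hmM _))
  intro hdvd
  exact Nat.not_dvd_ordCompl Fact.out (Nat.card_pos (α := G)).ne' (Int.natCast_dvd_natCast.1 hdvd)

end Separation

/-! ### Composition, inversion and rigidity of perfect isometries -/

section PerfectIsometries

variable {M : Ideal (integralClosure ℤ ℂ)} {G H K : Type*} [Group G] [Fintype G] [Group H]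
  [Fintype H] [Group K] [Fintype K] {B : Block M G} {B' : Block M H} {B'' : Block M K}

theorem Block.exists_eq_sum (x : B.ZIrr) : ∃ n : B.irr → ℤ, x = ∑ χ, n χ • B.toZIrr χ := by
  have hx : (x : G → ℂ) ∈ Submodule.span ℤ (Set.range (Subtype.val : B.irr → G → ℂ)) := by
    rw [Subtype.range_coe]; exact x.2
  obtain ⟨n, hn⟩ := (Submodule.mem_span_range_iff_exists_fun ℤ).1 hx
  exact ⟨n, Subtype.ext (by rw [← hn]; simp [toZIrr])⟩

omit [Fintype G] in
theorem coe_sum_smul {ι : Type*} (s : Finset ι) (n : ι → ℤ) (f : ι → B.ZIrr) :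
    ((∑ i ∈ s, n i • f i : B.ZIrr) : G → ℂ) = ∑ i ∈ s, (n i : ℂ) • (f i : G → ℂ) := by
  rw [Submodule.coe_sum]
  exact sum_congr rfl fun i _ => by ext g; simp

theorem scalarProd_sum_smul_toZIrr (n : B.irr → ℤ) (χ : B.irr) :
    scalarProd ((∑ ψ, n ψ • B.toZIrr ψ : B.ZIrr) : G → ℂ) χ = n χ := by
  rw [coe_sum_smul, scalarProd_sum_left, sum_eq_single χ]
  · rw [show ((B.toZIrr χ : B.ZIrr) : G → ℂ) = χ from rfl,
      scalarProd_irr (B.irr_subset χ.2) (B.irr_subset χ.2), if_pos rfl, mul_one]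
  · intro ψ _ hne
    rw [show ((B.toZIrr ψ : B.ZIrr) : G → ℂ) = ψ from rfl,
      scalarProd_irr (B.irr_subset ψ.2) (B.irr_subset χ.2),
      if_neg (fun h => hne (Subtype.ext h)), mul_zero]
  · exact fun h => absurd (mem_univ _) h

-- Taking `I` to be the identity gives the expansion of `x` in irreducible characters.
omit [Fintype H] in
theorem map_apply_eq_sum (I : B.ZIrr ≃ₗ[ℤ] B'.ZIrr) (x : B.ZIrr) (h : H) :
    (I x : H → ℂ) h = ∑ χ : B.irr, scalarProd (x : G → ℂ) χ * (I (B.toZIrr χ) : H → ℂ) h := by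
  obtain ⟨n, rfl⟩ := B.exists_eq_sum x
  simp only [scalarProd_sum_smul_toZIrr]
  rw [map_sum]
  simp only [map_smul]
  rw [coe_sum_smul]
  simp

theorem zirr_conj (x : B.ZIrr) {g h : G} (hgh : IsConj g h) : (x : G → ℂ) g = (x : G → ℂ) h := by
  have := map_apply_eq_sum (LinearEquiv.refl ℤ B.ZIrr) x
  simp only [LinearEquiv.refl_apply] at this
  rw [this, this]
  exact sum_congr rfl fun χ _ => congrArg _ (irr_conj (B.irr_subset χ.2) hgh)

theorem isIntegral_zirr (x : B.ZIrr) (g : G) : IsIntegral ℤ ((x : G → ℂ) g) := by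
  obtain ⟨n, rfl⟩ := B.exists_eq_sum x
  rw [coe_sum_smul, Finset.sum_apply]
  refine IsIntegral.sum _ fun χ _ => ?_
  exact (isIntegral_algebraMap (R := ℤ) (x := n χ)).mul (isIntegral_irr (B.irr_subset χ.2) g)

theorem isIntegral_mu (I : B.ZIrr ≃ₗ[ℤ] B'.ZIrr) (g : G) (h : H) : IsIntegral ℤ (mu I g h) :=
  IsIntegral.sum _ fun χ _ => (isIntegral_irr (B.irr_subset χ.2) g).mul (isIntegral_zirr _ h)

omit [Fintype H] in
theorem mu_conj_left (I : B.ZIrr ≃ₗ[ℤ] B'.ZIrr) {g g' : G} (h : H) (hg : IsConj g g') :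
    mu I g h = mu I g' h :=
  sum_congr rfl fun χ _ => by rw [irr_conj (B.irr_subset χ.2) hg]

theorem mu_conj_right (I : B.ZIrr ≃ₗ[ℤ] B'.ZIrr) (g : G) {h h' : H} (hh : IsConj h h') :
    mu I g h = mu I g h' :=
  sum_congr rfl fun χ _ => by rw [zirr_conj _ hh]

omit [Fintype K] in
theorem mu_trans (I : B.ZIrr ≃ₗ[ℤ] B'.ZIrr) (J : B'.ZIrr ≃ₗ[ℤ] B''.ZIrr) (g : G) (k : K) :
    mu (I.trans J) g k = (Nat.card H : ℂ)⁻¹ * ∑ h, mu I g h⁻¹ * mu J h k := by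
  have hsp : ∀ x (ψ : H → ℂ), scalarProd (I x : H → ℂ) ψ
      = (Nat.card H : ℂ)⁻¹ * ∑ h, ψ h * (I x : H → ℂ) h⁻¹ := fun x ψ => by
    rw [scalarProd_comm]; rfl
  unfold mu
  simp only [LinearEquiv.trans_apply, map_apply_eq_sum J (I _), hsp, mul_sum, sum_mul]
  rw [sum_comm]
  conv_lhs => enter [2, ψ]; rw [sum_comm]
  rw [sum_comm]
  refine sum_congr rfl fun h _ => sum_congr rfl fun ψ _ => sum_congr rfl fun χ _ => by ring

/-- The inverse of an isometry has the transposed matrix in the bases of irreducible characters. -/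
theorem mu_symm (I : B.ZIrr ≃ₗ[ℤ] B'.ZIrr)
    (hI : ∀ x y : B.ZIrr,
      scalarProd (I x : H → ℂ) (I y : H → ℂ) = scalarProd (x : G → ℂ) (y : G → ℂ))
    (g : G) (h : H) : mu I.symm h g = mu I g h := by
  unfold mu
  have h1 : ∀ ψ : B'.irr, (I.symm (B'.toZIrr ψ) : G → ℂ) g
      = ∑ χ : B.irr, scalarProd (I (B.toZIrr χ) : H → ℂ) ψ * (χ : G → ℂ) g := by
    intro ψ
    have := map_apply_eq_sum (LinearEquiv.refl ℤ B.ZIrr) (I.symm (B'.toZIrr ψ)) g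
    simp only [LinearEquiv.refl_apply] at this
    rw [this]
    refine sum_congr rfl fun χ _ => ?_
    rw [show ((χ : B.irr) : G → ℂ) = (B.toZIrr χ : G → ℂ) from rfl, ← hI,
      LinearEquiv.apply_symm_apply, scalarProd_comm]
    rfl
  have h2 : ∀ χ : B.irr, (I (B.toZIrr χ) : H → ℂ) h
      = ∑ ψ : B'.irr, scalarProd (I (B.toZIrr χ) : H → ℂ) ψ * (ψ : H → ℂ) h := fun χ =>
    map_apply_eq_sum (LinearEquiv.refl ℤ B'.ZIrr) (I (B.toZIrr χ)) h
  simp only [h1, h2, mul_sum]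
  rw [sum_comm]
  exact sum_congr rfl fun χ _ => sum_congr rfl fun ψ _ => by ring

variable {p : ℕ} [Fact p.Prime]

theorem groupPPart_dvd (h : H) :
    groupPPart p H ∣ Nat.card (conjugatesOf h) * centralizerPPart p h := by
  have hc : Nat.card (Subgroup.centralizer {h}) ≠ 0 := Nat.card_pos.ne'
  refine Nat.Coprime.dvd_of_dvd_mul_right (n :=
    Nat.card (Subgroup.centralizer {h}) / centralizerPPart p h)
    ((Nat.coprime_ordCompl Fact.out hc).pow_left _) ?_
  rw [mul_assoc, centralizerPPart, Nat.ordProj_mul_ordCompl_eq_self,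
    card_conjugatesOf_mul_card_centralizer]
  exact Nat.ordProj_dvd _ _

omit [Fintype H] in
theorem centralizerPPart_ne_zero (h : H) : (centralizerPPart p h : ℂ) ≠ 0 :=
  Nat.cast_ne_zero.2 (pow_pos (Fact.out : p.Prime).pos _).ne'

/-- Grouped by classes, each `F` value is weighted by the class size, and `|H|_p` divides the class
size times `|C_H(h)|_p`. This controls the average over `H` in `mu_trans`. -/
theorem isIntegral_groupPPrimePart_mul_average (F : H → ℂ) (hF : ∀ g h, IsConj g h → F g = F h)
    (hint : ∀ h, IsIntegral ℤ (F h / centralizerPPart p h)) :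
    IsIntegral ℤ ((groupPPrimePart p H : ℂ) * ((Nat.card H : ℂ)⁻¹ * ∑ h, F h)) := by
  rw [sum_eq_sum_conjClasses F hF, mul_sum, mul_sum]
  refine IsIntegral.sum _ fun c _ => ?_
  obtain ⟨d, hd⟩ := groupPPart_dvd (p := p) c.out
  have hd' : (Nat.card (conjugatesOf c.out) : ℂ) * centralizerPPart p c.out
      = groupPPart p H * d := by exact_mod_cast hd
  have hN : (groupPPart p H : ℂ) * groupPPrimePart p H = Nat.card H := by
    exact_mod_cast groupPPart_mul p H
  have hN0 : (Nat.card H : ℂ) ≠ 0 := Nat.cast_ne_zero.2 (Nat.card_pos (α := H)).ne'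
  have hm0 : (groupPPrimePart p H : ℂ) ≠ 0 := fun h => hN0 (by rw [← hN, h, mul_zero])
  have hν0 := groupPPart_ne_zero p H
  have hc0 := centralizerPPart_ne_zero (p := p) c.out
  have : (groupPPrimePart p H : ℂ) * ((Nat.card H : ℂ)⁻¹ *
      ((Nat.card (conjugatesOf c.out) : ℂ) * F c.out)) = d * (F c.out / centralizerPPart p c.out) := by
    rw [← hN]
    field_simp
    linear_combination F c.out * hd'
  rw [this]
  exact (isIntegral_natCast d).mul (hint _)

omit [Fintype H] [Fact p.Prime] in
theorem centralizerPPart_inv (h : H) : centralizerPPart p h⁻¹ = centralizerPPart p h := by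
  unfold centralizerPPart
  have : Subgroup.centralizer {h⁻¹} = Subgroup.centralizer {h} := by
    ext x
    simp only [Subgroup.mem_centralizer_singleton_iff]
    exact (Commute.inv_right_iff (a := x) (b := h))
  rw [this]

theorem IsPerfectIsometry.trans {I : B.ZIrr ≃ₗ[ℤ] B'.ZIrr} {J : B'.ZIrr ≃ₗ[ℤ] B''.ZIrr}
    (hI : IsPerfectIsometry p I) (hJ : IsPerfectIsometry p J) :
    IsPerfectIsometry p (I.trans J) where
  isometry x y := by
    rw [LinearEquiv.trans_apply, LinearEquiv.trans_apply, hJ.isometry, hI.isometry]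
  sep g k hx := by
    rw [mu_trans]
    -- Exactly one of `g`, `k` is p-regular, so `h` differs in type from one of them and that factor
    -- vanishes.
    refine mul_eq_zero_of_right _ (sum_eq_zero fun h _ => ?_)
    by_cases hh : IsPRegular p h
    · by_cases hg : IsPRegular p g
      · have hk : ¬ IsPRegular p k := fun hk => by simp [Xor, hg, hk] at hx
        rw [hJ.sep h k (Or.inl ⟨hh, hk⟩), mul_zero]
      · rw [hI.sep g h⁻¹ (Or.inr ⟨(isPRegular_inv p h).2 hh, hg⟩), zero_mul]
    · by_cases hg : IsPRegular p g
      · rw [hI.sep g h⁻¹ (Or.inl ⟨hg, fun h' => hh ((isPRegular_inv p h).1 h')⟩), zero_mul]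
      · have hk : IsPRegular p k := by
          by_contra hk; simp [Xor, hg, hk] at hx
        rw [hJ.sep h k (Or.inr ⟨hk, hh⟩), mul_zero]
  int_left g k := by
    -- Integrality is checked after multiplying by `|H|_{p'}`, using the average over `H`, and by
    -- the p-power denominator, using that `mu` is integral.
    refine isIntegral_of_coprime_mul (groupPPrimePart_coprime p H
      ((Nat.card (Subgroup.centralizer {g})).factorization p)) ?_ ?_
    · have h1 := isIntegral_groupPPrimePart_mul_average (p := p)
        (fun h => mu I g h⁻¹ / centralizerPPart p g * mu J h k)
        (fun a b hab => by rw [mu_conj_right I g (isConj_inv_inv hab), mu_conj_left J k hab])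
        (fun h => by rw [mul_div_assoc]; exact (hI.int_left g h⁻¹).mul (hJ.int_left h k))
      convert! h1 using 2
      rw [mu_trans, mul_div_assoc, sum_div]
      simp only [div_mul_eq_mul_div]
    · rw [show ((p ^ (Nat.card (Subgroup.centralizer {g})).factorization p : ℕ) : ℂ)
        = centralizerPPart p g from rfl, mul_div_cancel₀ _ (centralizerPPart_ne_zero g)]
      exact isIntegral_mu _ _ _
  int_right g k := by
    refine isIntegral_of_coprime_mul (groupPPrimePart_coprime p H
      ((Nat.card (Subgroup.centralizer {k})).factorization p)) ?_ ?_
    · have h1 := isIntegral_groupPPrimePart_mul_average (p := p)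
        (fun h => mu I g h⁻¹ * (mu J h k / centralizerPPart p k))
        (fun a b hab => by rw [mu_conj_right I g (isConj_inv_inv hab), mu_conj_left J k hab])
        (fun h => by
          rw [mul_div_right_comm, ← centralizerPPart_inv]
          exact (hI.int_right g h⁻¹).mul (hJ.int_right h k))
      convert! h1 using 2
      rw [mu_trans, mul_div_assoc, sum_div]
      simp only [mul_div_assoc]
    · rw [show ((p ^ (Nat.card (Subgroup.centralizer {k})).factorization p : ℕ) : ℂ)
        = centralizerPPart p k from rfl, mul_div_cancel₀ _ (centralizerPPart_ne_zero k)]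
      exact isIntegral_mu _ _ _

omit [Fact p.Prime] in
theorem IsPerfectIsometry.symm {I : B.ZIrr ≃ₗ[ℤ] B'.ZIrr} (hI : IsPerfectIsometry p I) :
    IsPerfectIsometry p I.symm where
  isometry x y := by
    rw [← hI.isometry, LinearEquiv.apply_symm_apply, LinearEquiv.apply_symm_apply]
  sep h g hx := by
    rw [mu_symm I hI.isometry]
    exact hI.sep g h hx.symm
  int_left h g := by
    rw [mu_symm I hI.isometry]
    exact hI.int_right g h
  int_right h g := by
    rw [mu_symm I hI.isometry]
    exact hI.int_left g h

theorem mu_refl (g h : G) :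
    mu (LinearEquiv.refl ℤ B.ZIrr) g h = ∑ χ : B.irr, (χ : G → ℂ) g * (χ : G → ℂ) h := rfl

theorem isSeparating_block [M.IsPrime] (hM : (p : integralClosure ℤ ℂ) ∈ M) (B : Block M G) :
    IsSeparating p B.irr.toFinset where
  irr χ hχ := B.irr_subset (Set.mem_toFinset.1 hχ)
  sep g u hg hu := by
    rw [Finset.sum_subtype (p := (· ∈ B.irr)) _ (fun χ => Set.mem_toFinset)]
    exact block_orthogonality p hM B hg hu

theorem isPerfectIsometry_refl [M.IsPrime] (hM : (p : integralClosure ℤ ℂ) ∈ M)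
    (B : Block M G) : IsPerfectIsometry p (LinearEquiv.refl ℤ B.ZIrr) := by
  have hcomm : ∀ g h : G, mu (LinearEquiv.refl ℤ B.ZIrr) g h
      = mu (LinearEquiv.refl ℤ B.ZIrr) h g := fun g h => by
    rw [mu_refl, mu_refl]
    exact sum_congr rfl fun χ _ => mul_comm _ _
  have hint : ∀ g h : G, IsIntegral ℤ
      (mu (LinearEquiv.refl ℤ B.ZIrr) g h / centralizerPPart p h) := fun g h => by
    have := (isSeparating_block hM B).isIntegral_div_centralizer g h
    rwa [Finset.sum_subtype (p := (· ∈ B.irr)) _ (fun χ => Set.mem_toFinset)] at this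
  refine ⟨fun x y => rfl, ?_, ?_, hint⟩
  · rintro g h (⟨hg, hh⟩ | ⟨hh, hg⟩)
    · exact block_orthogonality p hM B hg hh
    · rw [hcomm]; exact block_orthogonality p hM B hh hg
  · intro g h
    rw [hcomm]
    exact hint h g

theorem isPerfectIsometry_neg [M.IsPrime] (hM : (p : integralClosure ℤ ℂ) ∈ M)
    (B : Block M G) : IsPerfectIsometry p (LinearEquiv.neg ℤ : B.ZIrr ≃ₗ[ℤ] B.ZIrr) := by
  have hmu : ∀ g h : G, mu (LinearEquiv.neg ℤ : B.ZIrr ≃ₗ[ℤ] B.ZIrr) g h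
      = -mu (LinearEquiv.refl ℤ B.ZIrr) g h := fun g h => by
    simp [mu]
  have hr := isPerfectIsometry_refl (p := p) hM B
  refine ⟨fun x y => ?_, fun g h hx => ?_, fun g h => ?_, fun g h => ?_⟩
  · simp [scalarProd]
  · rw [hmu, hr.sep g h hx, neg_zero]
  · rw [hmu, neg_div]; exact (hr.int_left g h).neg
  · rw [hmu, neg_div]; exact (hr.int_right g h).neg

omit [Fintype H] in
theorem linearEquiv_ext_irr {I J : B.ZIrr ≃ₗ[ℤ] B'.ZIrr}
    (h : ∀ χ, I (B.toZIrr χ) = J (B.toZIrr χ)) : I = J := by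
  refine LinearEquiv.ext fun x => ?_
  obtain ⟨n, rfl⟩ := B.exists_eq_sum x
  simp only [map_sum, map_smul, h]

/-- A perfect isometry that fixes all irreducible characters up to signs is `±1`. -/
theorem IsPerfectIsometry.eq_refl_or_eq_neg [M.IsPrime] (hM : (p : integralClosure ℤ ℂ) ∈ M)
    {I : B.ZIrr ≃ₗ[ℤ] B.ZIrr} (hI : IsPerfectIsometry p I)
    (h : ∀ χ, I (B.toZIrr χ) = B.toZIrr χ ∨ I (B.toZIrr χ) = -B.toZIrr χ) :
    I = LinearEquiv.refl ℤ B.ZIrr ∨ I = LinearEquiv.neg ℤ := by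
  classical
  -- Adding `mu I` to `mu` of the identity cancels the characters of sign `-` and doubles the
  -- others, so the `+` part is separating.
  let T : Finset B.irr := univ.filter fun χ => I (B.toZIrr χ) = B.toZIrr χ
  let S : Finset (G → ℂ) := T.map (Function.Embedding.subtype _)
  have hmem : ∀ χ : B.irr, (χ : G → ℂ) ∈ S ↔ I (B.toZIrr χ) = B.toZIrr χ := fun χ => by
    simp [S, T]
  have hS : IsSeparating p S := by
    refine ⟨fun χ hχ => ?_, fun g u hg hu => ?_⟩
    · obtain ⟨ψ, -, rfl⟩ := Finset.mem_map.1 hχ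
      exact B.irr_subset ψ.2
    · have h1 := hI.sep g u (Or.inl ⟨hg, hu⟩)
      have h2 := block_orthogonality p hM B hg hu
      have h3 : 2 * ∑ χ ∈ S, χ g * χ u
          = ∑ χ : B.irr, (χ : G → ℂ) g * (χ : G → ℂ) u + mu I g u := by
        rw [Finset.sum_map, sum_filter, mu, ← sum_add_distrib, mul_sum]
        refine sum_congr rfl fun χ _ => ?_
        split_ifs with hc
        · rw [hc]
          simp only [Function.Embedding.coe_subtype, Block.toZIrr]
          ring
        · rw [(h χ).resolve_left hc]
          simp [Block.toZIrr]
      rw [h1, h2, add_zero] at h3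
      exact (mul_eq_zero.1 h3).resolve_left two_ne_zero
  by_cases hne : ∃ χ, I (B.toZIrr χ) = B.toZIrr χ
  · obtain ⟨χ, hχ⟩ := hne
    refine Or.inl (linearEquiv_ext_irr fun ψ => ?_)
    exact (hmem ψ).1 (hS.mem_of_sameBlock hM ((hmem χ).2 hχ) (B.irr_subset ψ.2)
      (B.sameBlock χ.2 ψ.2))
  · refine Or.inr (linearEquiv_ext_irr fun ψ => ?_)
    exact (h ψ).resolve_left fun hc => hne ⟨ψ, hc⟩

theorem scalarProd_toZIrr_self (χ : B.irr) :
    scalarProd (B.toZIrr χ : G → ℂ) (B.toZIrr χ : G → ℂ) = 1 := by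
  rw [show (B.toZIrr χ : G → ℂ) = χ from rfl,
    scalarProd_irr (B.irr_subset χ.2) (B.irr_subset χ.2), if_pos rfl]

theorem toZIrr_injective_up_to_sign {χ ψ : B.irr}
    (h : B.toZIrr χ = B.toZIrr ψ ∨ B.toZIrr χ = -B.toZIrr ψ) : χ = ψ := by
  by_contra hne
  have h0 : scalarProd (χ : G → ℂ) (ψ : G → ℂ) = 0 := by
    rw [scalarProd_irr (B.irr_subset χ.2) (B.irr_subset ψ.2),
      if_neg (fun h => hne (Subtype.ext h))]
  have h1 : scalarProd (ψ : G → ℂ) (ψ : G → ℂ) = 1 := scalarProd_toZIrr_self ψ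
  rcases h with h | h
  · have h2 : (χ : G → ℂ) = ψ := congrArg (fun x : B.ZIrr => (x : G → ℂ)) h
    rw [h2, h1] at h0
    exact one_ne_zero h0
  · have h2 : (χ : G → ℂ) = -ψ := congrArg (fun x : B.ZIrr => (x : G → ℂ)) h
    have h3 : scalarProd (-(ψ : G → ℂ)) ψ = -scalarProd (ψ : G → ℂ) ψ := by
      simp [scalarProd]
    rw [h2, h3, h1] at h0
    exact one_ne_zero (neg_eq_zero.1 h0)

/-- The integral coordinates of the image have squares summing to 1, so exactly one is nonzero and
it is `±1`. -/
theorem exists_signed_irr (I : B.ZIrr ≃ₗ[ℤ] B'.ZIrr)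
    (hI : ∀ x y : B.ZIrr,
      scalarProd (I x : H → ℂ) (I y : H → ℂ) = scalarProd (x : G → ℂ) (y : G → ℂ)) (χ : B.irr) :
    ∃ ψ : B'.irr, I (B.toZIrr χ) = B'.toZIrr ψ ∨ I (B.toZIrr χ) = -B'.toZIrr ψ := by
  obtain ⟨n, hn⟩ := B'.exists_eq_sum (I (B.toZIrr χ))
  have h1 : ∑ ψ, n ψ * n ψ = 1 := by
    have h2 := hI (B.toZIrr χ) (B.toZIrr χ)
    rw [scalarProd_toZIrr_self, hn, ← hn, scalarProd_comm] at h2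
    have h3 : scalarProd (I (B.toZIrr χ) : H → ℂ) (I (B.toZIrr χ) : H → ℂ)
        = ∑ ψ, (n ψ : ℂ) * n ψ := by
      conv_lhs => enter [1]; rw [hn]
      rw [coe_sum_smul, scalarProd_sum_left]
      refine sum_congr rfl fun ψ _ => ?_
      rw [show (B'.toZIrr ψ : H → ℂ) = ψ from rfl, scalarProd_comm, hn,
        scalarProd_sum_smul_toZIrr]
    rw [h3] at h2
    exact_mod_cast h2
  obtain ⟨ψ, hψ⟩ : ∃ ψ, n ψ ≠ 0 := by
    by_contra hc
    push Not at hc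
    simp [hc] at h1
  have hzero : ∀ φ, φ ≠ ψ → n φ = 0 := by
    intro φ hφ
    have h4 := add_le_sum (f := fun ψ => n ψ * n ψ) (fun i _ => mul_self_nonneg (n i))
      (mem_univ φ) (mem_univ ψ) hφ
    have h5 : 0 < n ψ * n ψ := mul_self_pos.2 hψ
    have h6 : n φ * n φ = 0 := le_antisymm (by linarith) (mul_self_nonneg _)
    exact mul_self_eq_zero.1 h6
  rw [sum_eq_single ψ (fun φ _ h => by rw [hzero φ h, mul_zero])
    (fun h => absurd (mem_univ _) h)] at h1
  rw [sum_eq_single ψ (fun φ _ h => by rw [hzero φ h, zero_smul])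
    (fun h => absurd (mem_univ _) h)] at hn
  refine ⟨ψ, ?_⟩
  rcases mul_self_eq_one_iff.1 h1 with h | h
  · left; rw [hn, h, one_smul]
  · right; rw [hn, h, neg_smul, one_smul]

end PerfectIsometries

/-! ### The group `PI(B)` and its signed permutation action -/

section PerfectIsometryGroup

variable {M : Ideal (integralClosure ℤ ℂ)} {G : Type*} [Group G] [Fintype G]
  {p : ℕ} [Fact p.Prime]

/-- The group `PI(B)` of perfect isometries `ℤIrr(B) → ℤIrr(B)`. -/
def perfectIsometryGroup [M.IsPrime] (hM : (p : integralClosure ℤ ℂ) ∈ M) (B : Block M G) :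
    Subgroup (B.ZIrr ≃ₗ[ℤ] B.ZIrr) where
  carrier := {I | IsPerfectIsometry p I}
  mul_mem' hI hJ := IsPerfectIsometry.trans hJ hI
  one_mem' := isPerfectIsometry_refl hM B
  inv_mem' hI := IsPerfectIsometry.symm hI

variable [M.IsPrime] {hM : (p : integralClosure ℤ ℂ) ∈ M} {B : Block M G}

/-- The character `Î(χ)` with `I(χ) = ± Î(χ)`. -/
noncomputable def signedImage (I : perfectIsometryGroup hM B) (χ : B.irr) : B.irr :=
  (exists_signed_irr I.1 I.2.isometry χ).choose

theorem signedImage_spec (I : perfectIsometryGroup hM B) (χ : B.irr) :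
    I.1 (B.toZIrr χ) = B.toZIrr (signedImage I χ) ∨
      I.1 (B.toZIrr χ) = -B.toZIrr (signedImage I χ) :=
  (exists_signed_irr I.1 I.2.isometry χ).choose_spec

/-- Uniqueness of the chosen character; it yields multiplicativity of `signedImage`. -/
theorem signedImage_eq {I : perfectIsometryGroup hM B} {χ ψ : B.irr}
    (h : I.1 (B.toZIrr χ) = B.toZIrr ψ ∨ I.1 (B.toZIrr χ) = -B.toZIrr ψ) :
    signedImage I χ = ψ := by
  refine toZIrr_injective_up_to_sign ?_
  rcases signedImage_spec I χ with h1 | h1 <;> rcases h with h2 | h2 <;> rw [h1] at h2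
  · exact Or.inl h2
  · exact Or.inr h2
  · exact Or.inr (neg_eq_iff_eq_neg.1 h2)
  · exact Or.inl (neg_injective h2)

theorem signedImage_one (χ : B.irr) : signedImage (1 : perfectIsometryGroup hM B) χ = χ :=
  signedImage_eq (Or.inl rfl)

theorem signedImage_mul (I J : perfectIsometryGroup hM B) (χ : B.irr) :
    signedImage (I * J) χ = signedImage I (signedImage J χ) := by
  refine signedImage_eq ?_
  have h : (I * J).1 (B.toZIrr χ) = I.1 (J.1 (B.toZIrr χ)) := rfl
  rw [h]
  rcases signedImage_spec J χ with h1 | h1 <;>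
    rcases signedImage_spec I (signedImage J χ) with h2 | h2 <;> simp [h1, h2]

/-- The homomorphism `I ↦ Î`. -/
noncomputable def signedImageHom (hM : (p : integralClosure ℤ ℂ) ∈ M) (B : Block M G) :
    perfectIsometryGroup hM B →* Equiv.Perm B.irr :=
  MonoidHom.toHomPerm
    { toFun := signedImage
      map_one' := funext signedImage_one
      map_mul' := fun I J => funext (signedImage_mul I J) }

theorem signedImageHom_apply (I : perfectIsometryGroup hM B) (χ : B.irr) :
    signedImageHom hM B I χ = signedImage I χ := rfl

theorem ker_signedImageHom (hneg : LinearEquiv.neg ℤ ∈ perfectIsometryGroup hM B) :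
    (signedImageHom hM B).ker
      = Subgroup.zpowers (⟨LinearEquiv.neg ℤ, hneg⟩ : perfectIsometryGroup hM B) := by
  refine le_antisymm (fun I hI => ?_) ?_
  · have h1 : ∀ χ, signedImage I χ = χ := fun χ => by
      rw [← signedImageHom_apply, MonoidHom.mem_ker.1 hI, Equiv.Perm.one_apply]
    have h2 := IsPerfectIsometry.eq_refl_or_eq_neg hM I.2 fun χ => by
      simpa only [h1] using signedImage_spec I χ
    rcases h2 with h | h
    · exact (show I = 1 from Subtype.ext h) ▸ Subgroup.one_mem _
    · exact (show I = ⟨LinearEquiv.neg ℤ, hneg⟩ from Subtype.ext h) ▸ Subgroup.mem_zpowers _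
  · rw [Subgroup.zpowers_le, MonoidHom.mem_ker]
    refine Equiv.ext fun χ => ?_
    exact signedImage_eq (Or.inr rfl)

end PerfectIsometryGroup

end PerfIso

theorem mainTheorem10 (p : ℕ) [Fact p.Prime] (M : Ideal (integralClosure ℤ ℂ)) [M.IsMaximal]
    (hM : (p : integralClosure ℤ ℂ) ∈ M)
    {G H : Type*} [Group G] [Fintype G] [Group H] [Fintype H]
    (B : PerfIso.Block M G) (B' : PerfIso.Block M H) :
    (∀ I J : B.ZIrr ≃ₗ[ℤ] B'.ZIrr,
      PerfIso.IsPerfectIsometry p I → PerfIso.IsPerfectIsometry p J →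
      (∀ χ : B.irr, I (B.toZIrr χ) = J (B.toZIrr χ) ∨ I (B.toZIrr χ) = -J (B.toZIrr χ)) →
      (∀ x, I x = J x) ∨ (∀ x, I x = -J x)) ∧
    (∃ PI : Subgroup (B.ZIrr ≃ₗ[ℤ] B.ZIrr),
      (∀ I, I ∈ PI ↔ PerfIso.IsPerfectIsometry p I) ∧
      ∃ hneg : LinearEquiv.neg ℤ ∈ PI,
      ∃ _ : (Subgroup.zpowers (⟨LinearEquiv.neg ℤ, hneg⟩ : PI)).Normal,
      ∃ Φ : (PI ⧸ Subgroup.zpowers (⟨LinearEquiv.neg ℤ, hneg⟩ : PI)) →* Equiv.Perm B.irr,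
        Function.Injective Φ ∧
        ∀ (I : PI) (χ : B.irr),
          I.1 (B.toZIrr χ) = B.toZIrr (Φ (QuotientGroup.mk I) χ) ∨
          I.1 (B.toZIrr χ) = -B.toZIrr (Φ (QuotientGroup.mk I) χ)) := by
  have hprime : M.IsPrime := Ideal.IsMaximal.isPrime ‹_›
  refine ⟨fun I J hI hJ h => ?_, PerfIso.perfectIsometryGroup hM B, fun I => Iff.rfl,
    PerfIso.isPerfectIsometry_neg hM B, ?_⟩
  -- The rigidity statement is applied to `J⁻¹ ∘ I`, a perfect isometry of `B` fixing each character
  -- up to sign.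
  · have h1 := (hI.trans hJ.symm).eq_refl_or_eq_neg hM fun χ => by
      rcases h χ with h | h <;> simp [h]
    rcases h1 with h1 | h1
    · left
      intro x
      have := LinearEquiv.congr_fun h1 x
      simpa [LinearEquiv.symm_apply_eq] using this
    · right
      intro x
      have := LinearEquiv.congr_fun h1 x
      rw [LinearEquiv.trans_apply, LinearEquiv.symm_apply_eq] at this
      rw [this]
      simp
  · have hker := PerfIso.ker_signedImageHom (hM := hM) (PerfIso.isPerfectIsometry_neg hM B)
    have hnormal : (Subgroup.zpowers (⟨LinearEquiv.neg ℤ, PerfIso.isPerfectIsometry_neg hM B⟩ :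
        PerfIso.perfectIsometryGroup hM B)).Normal :=
      hker ▸ (PerfIso.signedImageHom hM B).normal_ker
    refine ⟨hnormal, QuotientGroup.lift _ (PerfIso.signedImageHom hM B) hker.ge, ?_, ?_⟩
    · rw [injective_iff_map_eq_one]
      intro q hq
      induction q using QuotientGroup.induction_on with
      | H I =>
        rw [QuotientGroup.lift_mk] at hq
        exact (QuotientGroup.eq_one_iff I).2 (hker.le hq)
    · intro I χ
      exact PerfIso.signedImage_spec I χ
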